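/- Let $P_0$ be a probability measure on $\mathbb{R}^k$, let $Z(\beta)=\int e^{\beta\cdot x}\,dP_0(x)$, let $\Gamma=\{\beta: Z(\beta)<\infty\}$, and let $dP_\beta/dP_0(x)=e^{\beta\cdot x}/Z(\beta)$, $\beta\in\Gamma$, be the exponential family based on $P_0$. Assume that $\Gamma$ has interior points and that the convex core $cc(P_0)$ (the intersection of all convex measurable sets of $P_0$-probability $1$) has interior points. Let $M\subseteq\mathbb{R}^k$ be the mean value range of the family. For $y\in M$ let $P^y$ be the element with mean $y$, $\hat\beta(y)$ its canonical parameter and $V(y)$ its covariance matrix. For $y\in M$ and $x\in\mathbb{R}^k$ let $$D(x\|y)=\sup_{\beta\in\Gamma}\ln\frac{dP_\beta}{dP_0}(x)-\ln\frac{dP^y}{dP_0}(x)\in[0,\infty],$$ which for $x\in M$ is the information divergence $D(P^x\|P^y)$. Let $Q$ be the exponential prediction system based on $P_0$ with prior measure $\eta$ on $M$ ($\eta$ need not be finite). Given a string $x^m=(x_1,\dots,x_m)$ in $\mathbb{R}^k$, $m\ge 0$, with average $\bar x$ and $0<\int_M e^{-mD(\bar x\|z)}\,d\eta(z)<\infty$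 (that is, $Q$ is defined given $x^m$; for $m=0$ the integrand is $1$), it predicts the outcomes after $x^m$ by the density with respect to $P_0$ $$Q(x^n|x^m)=\frac{\int_M\prod_{i=m+1}^n\frac{dP^z}{dP_0}(x_i)\;e^{-mD(\bar x\|z)}\,d\eta(z)}{\int_M e^{-mD(\bar x\|z)}\,d\eta(z)} .$$ For a sequence $x_1,x_2,\dots$ extending $x^m$, with averages $\bar x_n$ of $x_1,\dots,x_n$, the conditional regret is $$REG(x^n|x^m)=\ln\frac{\prod_{i=1}^n\frac{dP^{\bar x_n}}{dP_0}(x_i)}{Q(x^n|x^m)},$$ and the conditional Jeffreys integral is $J|x^m=\int_{\operatorname{int}M} e^{-mD(\bar x\|y)}(\det V(y))^{-1/2}\,dy$. Then for every string $x^m$ given which $Q$ is defined and for which $J|x^m<\infty$ there is an interior point $x\in M$ of the convex core $cc(P_0)$, corresponding to an element $P^x$ of the family, such that: 1. $x^m$ can be continued to a sequence $x_1,x_2,\dots$ in $\mathbb{R}^k$ with $x_n\to x$ and $$\liminf_{n\to\infty}\Bigl(REG(x^n|x^m)-\frac k2\ln\frac n{2\pi}\Bigr)\ge\ln(J|x^m);$$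 2. $x^m$ can also be continued by outcomes $x_{m+1},x_{m+2},\dots$ in the support of $P_0$ such that $\bar x_n\to x$ and the same inequality holds. -/

import Mathlib

open MeasureTheory Set Filter Topology
open scoped ENNReal

noncomputable section

namespace ExpFam

variable {d : ℕ}

/-- The partition function `Z(β) = ∫ exp(β·x) dP₀(x)`, used for `β` in `canonicalSpace P₀`. -/
def partition (P₀ : Measure (EuclideanSpace ℝ (Fin d))) (β : EuclideanSpace ℝ (Fin d)) : ℝ :=
  ∫ x, Real.exp (inner ℝ β x) ∂P₀

/-- The canonical parameter space `Γ = {β | Z(β) < ∞}`. -/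
def canonicalSpace (P₀ : Measure (EuclideanSpace ℝ (Fin d))) : Set (EuclideanSpace ℝ (Fin d)) :=
  {β | Integrable (fun x => Real.exp (inner ℝ β x)) P₀}

/-- The density `dP_β/dP₀ (x) = exp(β·x) / Z(β)`. -/
def density (P₀ : Measure (EuclideanSpace ℝ (Fin d))) (β x : EuclideanSpace ℝ (Fin d)) : ℝ :=
  Real.exp (inner ℝ β x) / partition P₀ β

/-- The element `P_β` of the exponential family. -/
def element (P₀ : Measure (EuclideanSpace ℝ (Fin d))) (β : EuclideanSpace ℝ (Fin d)) :
    Measure (EuclideanSpace ℝ (Fin d)) :=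
  P₀.withDensity fun x => ENNReal.ofReal (density P₀ β x)

/-- `P_β` is an element of the exponential family with (finite) mean value `y`. -/
def HasMean (P₀ : Measure (EuclideanSpace ℝ (Fin d))) (β y : EuclideanSpace ℝ (Fin d)) : Prop :=
  β ∈ canonicalSpace P₀ ∧ Integrable (fun x => x) (element P₀ β) ∧ ∫ x, x ∂(element P₀ β) = y

/-- The mean value range `M` of the exponential family. -/
def meanRange (P₀ : Measure (EuclideanSpace ℝ (Fin d))) : Set (EuclideanSpace ℝ (Fin d)) :=
  {y | ∃ β, HasMean P₀ β y}

open scoped Classical in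
/-- The canonical parameter `β̂(y)` of the element with mean value `y ∈ M`
(it is set to `0` outside `M`). -/
def betaHat (P₀ : Measure (EuclideanSpace ℝ (Fin d))) (y : EuclideanSpace ℝ (Fin d)) :
    EuclideanSpace ℝ (Fin d) :=
  if h : ∃ β, HasMean P₀ β y then h.choose else 0

/-- The convex core: the intersection of all convex measurable sets of probability one. -/
def convexCore (P₀ : Measure (EuclideanSpace ℝ (Fin d))) : Set (EuclideanSpace ℝ (Fin d)) :=
  ⋂₀ {C | Convex ℝ C ∧ MeasurableSet C ∧ P₀ C = 1}

/-- The covariance matrix `V(y)` of the element `P^y` of the exponential family. -/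
def covMatrix (P₀ : Measure (EuclideanSpace ℝ (Fin d))) (y : EuclideanSpace ℝ (Fin d)) :
    Matrix (Fin d) (Fin d) ℝ :=
  Matrix.of fun i j =>
    ProbabilityTheory.covariance (fun x : EuclideanSpace ℝ (Fin d) => x i)
      (fun x : EuclideanSpace ℝ (Fin d) => x j) (element P₀ (betaHat P₀ y))

/-- The maximal log-likelihood `sup_β ln (dP_β/dP₀)(x)` of a point `x` (possibly `⊤`). -/
def maxLogLikelihood (P₀ : Measure (EuclideanSpace ℝ (Fin d))) (x : EuclideanSpace ℝ (Fin d)) :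
    EReal :=
  ⨆ β ∈ canonicalSpace P₀, ((Real.log (density P₀ β x) : ℝ) : EReal)

/-- The (Bregman) divergence `D(x‖y)`, `y ∈ M`: the log-likelihood ratio at `x` between the
maximum likelihood distribution `P^x` and `P^y`. For `x, y ∈ M` it is the information divergence
`D(P^x‖P^y) = ∫ ln (dP^x/dP^y) dP^x` (proved below, `divergence_eq_klDiv`); in this form it also
makes sense for averages `x` on the boundary of the convex core, where `P^x` belongs to the
extended family, and it is the function in the posterior density `∝ exp(-m D(x̄‖y))`. -/
def divergence (P₀ : Measure (EuclideanSpace ℝ (Fin d))) (x y : EuclideanSpace ℝ (Fin d)) :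
    EReal :=
  maxLogLikelihood P₀ x - ((Real.log (density P₀ (betaHat P₀ y) x) : ℝ) : EReal)

/-- The sample average of `x₁, …, xₙ`. -/
def sampleMean {n : ℕ} (x : Fin n → EuclideanSpace ℝ (Fin d)) : EuclideanSpace ℝ (Fin d) :=
  (n : ℝ)⁻¹ • ∑ i, x i

/-- `exp(-m D(x̄‖y))` for a string `x^m` with average `x̄` (equal to `1` for `m = 0`). -/
def posteriorWeight (P₀ : Measure (EuclideanSpace ℝ (Fin d))) {m : ℕ}
    (xm : Fin m → EuclideanSpace ℝ (Fin d)) (y : EuclideanSpace ℝ (Fin d)) : ℝ≥0∞ :=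
  EReal.exp (-((m : EReal) * divergence P₀ (sampleMean xm) y))

/-- The prior integral `∫_M exp(-m D(x̄‖z)) dη(z)`, for `η` concentrated on `M`. -/
def priorIntegral (P₀ η : Measure (EuclideanSpace ℝ (Fin d))) {m : ℕ}
    (xm : Fin m → EuclideanSpace ℝ (Fin d)) : ℝ≥0∞ :=
  ∫⁻ z, posteriorWeight P₀ xm z ∂η

/-- The predictions given `x^m` of the system with prior `η` are defined: the prior can be
normalized to the posterior probability measure given `x^m`. -/
def IsDefinedAt (P₀ η : Measure (EuclideanSpace ℝ (Fin d))) {m : ℕ}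
    (xm : Fin m → EuclideanSpace ℝ (Fin d)) : Prop :=
  priorIntegral P₀ η xm ≠ 0 ∧ priorIntegral P₀ η xm ≠ ∞

/-- The density with respect to `P₀` of the prediction `Q(x^n | x^m)` of `x_{m+1}, …, x_n` given
`x^m`, for the exponential prediction system based on `P₀` with prior `η`: the mixture
`∫_M ∏_{m < i ≤ n} (dP^z/dP₀)(x_i) dν(z)` over the posterior `ν` given `x^m`, i.e. over
`dν(z) = exp(-m D(x̄‖z)) dη(z) / ∫_M exp(-m D(x̄‖z)) dη(z)`.
The outcome `x_{i+1}` is `ω i`. -/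
def predictiveDensity (P₀ η : Measure (EuclideanSpace ℝ (Fin d))) (m n : ℕ)
    (ω : ℕ → EuclideanSpace ℝ (Fin d)) : ℝ≥0∞ :=
  (∫⁻ z, (∏ i ∈ Finset.Ico m n, ENNReal.ofReal (density P₀ (betaHat P₀ z) (ω i))) *
      posteriorWeight P₀ (fun i : Fin m => ω i) z ∂η) /
    priorIntegral P₀ η (fun i : Fin m => ω i)

/-- The conditional regret `REG(x^n | x^m) = ln (P^{x̄}(x^n) / Q(x^n | x^m))`, `x̄` being the average
of `x^n`, with densities with respect to `P₀`. -/
def regret (P₀ η : Measure (EuclideanSpace ℝ (Fin d))) (m n : ℕ)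
    (ω : ℕ → EuclideanSpace ℝ (Fin d)) : EReal :=
  ENNReal.log
    (ENNReal.ofReal
        (∏ i ∈ Finset.range n, density P₀ (betaHat P₀ (sampleMean fun i : Fin n => ω i)) (ω i)) /
      predictiveDensity P₀ η m n ω)

/-- The conditional Jeffreys integral `J | x^m = ∫ exp(-m D(x̄‖y)) / (det V(y))^{1/2} dy`,
over the interior of the mean value range `M` (the image of the interior of `Γ`). -/
def condJeffreys (P₀ : Measure (EuclideanSpace ℝ (Fin d))) {m : ℕ}
    (xm : Fin m → EuclideanSpace ℝ (Fin d)) : ℝ≥0∞ :=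
  ∫⁻ y in interior (meanRange P₀),
    posteriorWeight P₀ xm y / ENNReal.ofReal (Real.sqrt (covMatrix P₀ y).det)

theorem element_eq_tilted (P₀ : Measure (EuclideanSpace ℝ (Fin d)))
    (β : EuclideanSpace ℝ (Fin d)) :
    element P₀ β = P₀.tilted (fun x => inner ℝ β x) := rfl

theorem hasMean_betaHat {P₀ : Measure (EuclideanSpace ℝ (Fin d))} {y : EuclideanSpace ℝ (Fin d)}
    (hy : y ∈ meanRange P₀) : HasMean P₀ (betaHat P₀ y) y := by
  have h : ∃ β, HasMean P₀ β y := hy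
  simp only [betaHat, dif_pos h]
  exact h.choose_spec

theorem log_density {P₀ : Measure (EuclideanSpace ℝ (Fin d))} [IsProbabilityMeasure P₀]
    {β : EuclideanSpace ℝ (Fin d)} (hβ : β ∈ canonicalSpace P₀) (x : EuclideanSpace ℝ (Fin d)) :
    Real.log (density P₀ β x) = inner ℝ β x - Real.log (partition P₀ β) := by
  have hZ : 0 < partition P₀ β := integral_exp_pos hβ
  rw [density, Real.log_div (Real.exp_pos _).ne' hZ.ne', Real.log_exp]

/-- The information divergence between two elements of the family, the first one with mean `x`. -/
theorem klDiv_element {P₀ : Measure (EuclideanSpace ℝ (Fin d))} [IsProbabilityMeasure P₀]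
    {β γ x : EuclideanSpace ℝ (Fin d)} (hβ : HasMean P₀ β x) (hγ : γ ∈ canonicalSpace P₀) :
    0 ≤ Real.log (density P₀ β x) - Real.log (density P₀ γ x) ∧
    InformationTheory.klDiv (element P₀ β) (element P₀ γ) =
      ENNReal.ofReal (Real.log (density P₀ β x) - Real.log (density P₀ γ x)) := by
  obtain ⟨hβΓ, hint, hmean⟩ := hβ
  have hpβ : IsProbabilityMeasure (element P₀ β) := by
    rw [element_eq_tilted]; exact isProbabilityMeasure_tilted hβΓ
  have hpγ : IsProbabilityMeasure (element P₀ γ) := by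
    rw [element_eq_tilted]; exact isProbabilityMeasure_tilted hγ
  have hac0 : element P₀ β ≪ P₀ := by
    rw [element_eq_tilted]; exact tilted_absolutelyContinuous _ _
  have hac : element P₀ β ≪ element P₀ γ := by
    refine hac0.trans ?_
    rw [element_eq_tilted]; exact absolutelyContinuous_tilted hγ
  have hllr : llr (element P₀ β) (element P₀ γ) =ᵐ[element P₀ β]
      fun z => Real.log (density P₀ β z) - Real.log (density P₀ γ z) := by
    have h1 := llr_tilted_right (μ := element P₀ β) (ν := P₀) (f := fun x => inner ℝ γ x) hac0 hγ
    have h2 := hac0.ae_le (log_rnDeriv_tilted_left_self (μ := P₀) (f := fun x => inner ℝ β x) hβΓ)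
    filter_upwards [h1, h2] with z hz1 hz2
    rw [log_density hβΓ, log_density hγ]
    rw [element_eq_tilted P₀ γ, hz1]
    simp only [llr, element_eq_tilted P₀ β]
    rw [hz2]
    simp only [partition]
    ring
  have hin : ∀ b : EuclideanSpace ℝ (Fin d), Integrable (fun z => inner ℝ b z) (element P₀ β) :=
    fun b => hint.const_inner b
  have hval : ∀ b : EuclideanSpace ℝ (Fin d),
      ∫ z, inner ℝ b z ∂(element P₀ β) = inner ℝ b x := fun b => by
    rw [← hmean]; exact integral_inner hint b
  have hld : ∀ {b : EuclideanSpace ℝ (Fin d)}, b ∈ canonicalSpace P₀ →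
      (Integrable (fun z => Real.log (density P₀ b z)) (element P₀ β) ∧
      ∫ z, Real.log (density P₀ b z) ∂(element P₀ β) = Real.log (density P₀ b x)) := by
    intro b hb
    simp only [log_density hb]
    refine ⟨(hin b).sub (integrable_const _), ?_⟩
    rw [integral_sub (hin b) (integrable_const _), hval]
    simp
  have hllrint : Integrable (llr (element P₀ β) (element P₀ γ)) (element P₀ β) :=
    (integrable_congr hllr).2 ((hld hβΓ).1.sub (hld hγ).1)
  have hI : ∫ z, llr (element P₀ β) (element P₀ γ) z ∂(element P₀ β) =
      Real.log (density P₀ β x) - Real.log (density P₀ γ x) := by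
    rw [integral_congr_ae hllr, integral_sub (hld hβΓ).1 (hld hγ).1, (hld hβΓ).2, (hld hγ).2]
  have hnn := InformationTheory.integral_llr_add_sub_measure_univ_nonneg hac hllrint
  have hkl := InformationTheory.klDiv_of_ac_of_integrable hac hllrint
  rw [hI] at hnn hkl
  simp only [probReal_univ, add_sub_cancel_right] at hnn hkl
  exact ⟨hnn, hkl⟩

/-- On the mean value range the divergence is the information divergence. -/
theorem divergence_eq_klDiv {P₀ : Measure (EuclideanSpace ℝ (Fin d))} [IsProbabilityMeasure P₀]
    {x y : EuclideanSpace ℝ (Fin d)} (hx : x ∈ meanRange P₀) (hy : y ∈ meanRange P₀) :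
    divergence P₀ x y =
      ((InformationTheory.klDiv (element P₀ (betaHat P₀ x)) (element P₀ (betaHat P₀ y)) : ℝ≥0∞) :
        EReal) := by
  have hbx := hasMean_betaHat hx
  have hby := hasMean_betaHat hy
  have hmax : maxLogLikelihood P₀ x = ((Real.log (density P₀ (betaHat P₀ x) x) : ℝ) : EReal) := by
    refine le_antisymm (iSup₂_le fun γ hγ => ?_) ?_
    · exact_mod_cast sub_nonneg.1 (klDiv_element hbx hγ).1
    · exact le_iSup₂ (f := fun β (_ : β ∈ canonicalSpace P₀) =>
        ((Real.log (density P₀ β x) : ℝ) : EReal)) _ hbx.1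
  obtain ⟨h0, h1⟩ := klDiv_element hbx hby.1
  rw [divergence, hmax, h1, EReal.coe_ennreal_ofReal, max_eq_left h0, EReal.coe_sub]

end ExpFam

end

/-! Write w(z) = exp(-m D(x̄‖z)), I = ∫ w dη, J = J|x^m, and let g be the density of the absolutely
continuous part of w·η on int M. Since ∫ g dy ≤ I, the inequality g·J > (w/√det V)·I cannot hold
almost everywhere on int M: integrating it would give I·J < I·J. So there is a point x, which is
moreover a differentiation point of w·η, with g(x)·√det V(x)·J ≤ w(x)·I (`exists_rnDeriv_mul_le`).

Along a continuation whose sums s = ∑ (x_i - x) stay bounded, the likelihood of P^z relative to P^x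
on the new outcomes is exp(-(n-m) D(x‖z) + ⟨β̂(z) - β̂(x), s⟩) (`predictiveDensity_eq`). Hence
Q(x^n|x^m) is the P^x-density of the new outcomes times a Laplace integral divided by I. Near x the
divergence is quadratic with matrix V(x)⁻¹; away from x it grows at least linearly in the canonical
parameter. The integral is therefore at most about g(x)·√det V(x)·(2π/n)^{k/2}
(`eventually_laplace_le`), which by the choice of x is at most w(x)·(I/J)·(2π/n)^{k/2}. In the
regret I cancels, and so does w(x), because the maximum likelihood element does at least as well as
P^x, whose density on x^m is at least w(x). What remains is J·(n/2π)^{k/2} (`le_liminf_regret`).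

The prior may be singular, since only an upper bound is needed. Differentiation along ellipsoids
shaped by V(x), valid at almost every x for all shapes at once (`ae_tendsto_rnDeriv_ellipsoid`),
bounds the mass of small ellipsoids, and the layer-cake formula turns this into a bound for Gaussian
integrals.

Bounded sums are obtained either by repeating x, or by a greedy choice of support points, possible
because x is interior to the convex core (`exists_support_seq_bounded_sum`). -/

section Ellipsoid

/-! ### Ellipsoids: differentiation of measures and Gaussian integrals. -/

variable {E : Type*} [NormedAddCommGroup E] [InnerProductSpace ℝ E] [FiniteDimensional ℝ E]
  [MeasurableSpace E] [BorelSpace E]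

/-- The solid ellipsoid `{z | ‖T (z - x)‖ ≤ r}`. -/
def ellipsoid (T : E ≃L[ℝ] E) (x : E) (r : ℝ) : Set E := {z | ‖T (z - x)‖ ≤ r}

omit [FiniteDimensional ℝ E] [MeasurableSpace E] [BorelSpace E] in
theorem isClosed_ellipsoid (T : E ≃L[ℝ] E) (x : E) (r : ℝ) : IsClosed (ellipsoid T x r) :=
  isClosed_le (by fun_prop) continuous_const

omit [FiniteDimensional ℝ E] [MeasurableSpace E] [BorelSpace E] in
theorem ellipsoid_subset_closedBall (T : E ≃L[ℝ] E) (x : E) (r : ℝ) :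
    ellipsoid T x r ⊆ Metric.closedBall x (‖(T.symm : E →L[ℝ] E)‖ * r) := by
  intro z hz
  rw [mem_closedBall_iff_norm]
  calc ‖z - x‖ = ‖(T.symm : E →L[ℝ] E) (T (z - x))‖ := by simp
    _ ≤ ‖(T.symm : E →L[ℝ] E)‖ * ‖T (z - x)‖ := ContinuousLinearMap.le_opNorm _ _
    _ ≤ _ := by gcongr; exact hz

omit [FiniteDimensional ℝ E] [MeasurableSpace E] [BorelSpace E] in
theorem closedBall_subset_ellipsoid (T : E ≃L[ℝ] E) (x : E) (r : ℝ) :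
    Metric.closedBall x (r / (‖(T : E →L[ℝ] E)‖ + 1)) ⊆ ellipsoid T x r := by
  intro z hz
  rw [mem_closedBall_iff_norm, le_div_iff₀ (by positivity)] at hz
  calc ‖T (z - x)‖ ≤ ‖(T : E →L[ℝ] E)‖ * ‖z - x‖ := (T : E →L[ℝ] E).le_opNorm _
    _ ≤ ‖z - x‖ * (‖(T : E →L[ℝ] E)‖ + 1) := by nlinarith [norm_nonneg (z - x)]
    _ ≤ r := hz

open scoped NNReal in
/-- Lebesgue differentiation of a finite measure along ellipsoids of any fixed shape. -/
theorem ae_tendsto_rnDeriv_ellipsoid (μ : Measure E) [IsFiniteMeasure μ] :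
    ∀ᵐ x : E, ∀ T : E ≃L[ℝ] E,
      Tendsto (fun r => μ (ellipsoid T x r) / volume (ellipsoid T x r)) (𝓝[>] 0)
        (𝓝 (μ.rnDeriv volume x)) := by
  -- Ellipsoids of a given shape belong to a Vitali family as soon as its constant exceeds a bound
  -- set by their eccentricity. Integer constants suffice, so a single null set serves the
  -- uncountably many shapes `T`.
  have h3 : ∀ (N : ℕ) (x : E), ∃ᶠ r in 𝓝[>] (0 : ℝ), volume (Metric.closedBall x (3 * r)) ≤
      ((3 ^ Module.finrank ℝ E + N : ℕ) : ℝ≥0) * volume (Metric.closedBall x r) := by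
    intro N x
    refine Eventually.frequently ?_
    filter_upwards [self_mem_nhdsWithin] with r hr
    have hr : 0 < r := hr
    rw [Measure.addHaar_closedBall _ _ (by positivity), Measure.addHaar_closedBall _ _ hr.le,
      mul_pow, ENNReal.ofReal_mul (by positivity), mul_assoc]
    gcongr
    rw [ENNReal.ofReal_pow (by norm_num)]
    simp
  have hae : ∀ N : ℕ, ∀ᵐ x : E, Tendsto (fun a => μ a / volume a)
      ((Vitali.vitaliFamily volume _ (h3 N)).filterAt x) (𝓝 (μ.rnDeriv volume x)) :=
    fun N => VitaliFamily.ae_tendsto_rnDeriv _ _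
  filter_upwards [ae_all_iff.2 hae] with x hx T
  set a : ℝ := ‖(T.symm : E →L[ℝ] E)‖ with ha
  set b : ℝ := ‖(T : E →L[ℝ] E)‖ + 1 with hb
  have hb0 : 0 < b := by positivity
  -- The ratio of the volumes of the tripled enclosing ball, of radius `3 * (a + 1) * r`, and the
  -- inscribed ball, of radius `r / b`.
  obtain ⟨N, hN⟩ := exists_nat_ge ((3 * (a + 1) * b) ^ Module.finrank ℝ E)
  refine (hx N).comp ?_
  rw [VitaliFamily.tendsto_filterAt_iff]
  constructor
  · filter_upwards [self_mem_nhdsWithin] with r hr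
    have hr : 0 < r := hr
    refine ⟨isClosed_ellipsoid T x r, ?_, (a + 1) * r, ?_, ?_⟩
    · refine ⟨x, interior_mono (closedBall_subset_ellipsoid T x r) ?_⟩
      exact mem_interior_iff_mem_nhds.2 (Metric.closedBall_mem_nhds _ (by positivity))
    · refine (ellipsoid_subset_closedBall T x r).trans (Metric.closedBall_subset_closedBall ?_)
      gcongr; linarith
    · calc volume (Metric.closedBall x (3 * ((a + 1) * r)))
          = ENNReal.ofReal ((3 * (a + 1) * b) ^ Module.finrank ℝ E) *
            volume (Metric.closedBall x (r / b)) := by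
            rw [Measure.addHaar_closedBall _ _ (by positivity),
              Measure.addHaar_closedBall _ _ (by positivity), ← mul_assoc (ENNReal.ofReal _),
              ← ENNReal.ofReal_mul (by positivity), ← mul_pow]
            congr 3
            field_simp
        _ ≤ _ := by
            gcongr
            · refine (ENNReal.ofReal_le_ofReal hN).trans ?_
              rw [ENNReal.ofReal_natCast]
              push_cast
              simp
            · exact closedBall_subset_ellipsoid T x r
  · intro ε hε
    have : Tendsto (fun r : ℝ => a * r) (𝓝[>] 0) (𝓝 0) := by
      have : Tendsto (fun r : ℝ => a * r) (𝓝 0) (𝓝 (a * 0)) :=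
        Continuous.tendsto (by fun_prop) 0
      rw [mul_zero] at this
      exact this.mono_left nhdsWithin_le_nhds
    filter_upwards [this.eventually (gt_mem_nhds hε)] with r hr
    exact (ellipsoid_subset_closedBall T x r).trans (Metric.closedBall_subset_closedBall hr.le)

omit [FiniteDimensional ℝ E] in
theorem measurableSet_ellipsoid (T : E ≃L[ℝ] E) (x : E) (r : ℝ) :
    MeasurableSet (ellipsoid T x r) := (isClosed_ellipsoid T x r).measurableSet

/-- A measure dominated by `a` times the volume on small concentric ellipsoids integrates
the corresponding Gaussian kernels like `a` times the volume. -/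
theorem setLIntegral_gaussian_le_of_ellipsoid (μ : Measure E) (T : E ≃L[ℝ] E) (x : E) {a : ℝ≥0∞}
    {r₀ b : ℝ} (hr₀ : 0 < r₀) (hb : 0 < b) (ha : a ≠ ∞)
    (h : ∀ r, 0 < r → r ≤ r₀ → μ (ellipsoid T x r) ≤ a * volume (ellipsoid T x r)) :
    ∫⁻ z in ellipsoid T x r₀, ENNReal.ofReal (Real.exp (-b * ‖T (z - x)‖ ^ 2)) ∂μ ≤
      a * ∫⁻ z in ellipsoid T x r₀, ENNReal.ofReal (Real.exp (-b * ‖T (z - x)‖ ^ 2)) := by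
  have hm : Measurable fun z => Real.exp (-b * ‖T (z - x)‖ ^ 2) :=
    Continuous.measurable (by fun_prop)
  -- Layer-cake formula: within the ellipsoid, the superlevel sets of the kernel are smaller
  -- concentric ellipsoids of the same shape, to which `h` applies.
  rw [lintegral_eq_lintegral_meas_le _ (Eventually.of_forall fun z => (Real.exp_pos _).le)
    hm.aemeasurable, lintegral_eq_lintegral_meas_le _
    (Eventually.of_forall fun z => (Real.exp_pos _).le) hm.aemeasurable,
    ← lintegral_const_mul' _ _ ha]
  refine lintegral_mono_ae ?_
  -- At level 1 the superlevel set is the point `x`, an ellipsoid of radius 0 not covered by `h`;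
  -- this one level is negligible.
  have h1 : ∀ᵐ t : ℝ ∂volume.restrict (Ioi 0), t ≠ 1 :=
    ae_restrict_of_ae (Measure.ae_ne volume 1)
  filter_upwards [h1, ae_restrict_mem measurableSet_Ioi] with t ht1 ht0
  have ht0 : 0 < t := ht0
  have hms : MeasurableSet {z | t ≤ Real.exp (-b * ‖T (z - x)‖ ^ 2)} :=
    measurableSet_le measurable_const hm
  rw [Measure.restrict_apply hms, Measure.restrict_apply hms]
  rcases lt_or_gt_of_ne ht1 with ht | ht
  · have hl : 0 < -Real.log t / b := div_pos (neg_pos.2 (Real.log_neg ht0 ht)) hb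
    have : {z | t ≤ Real.exp (-b * ‖T (z - x)‖ ^ 2)} ∩ ellipsoid T x r₀ =
        ellipsoid T x (min (Real.sqrt (-Real.log t / b)) r₀) := by
      ext z
      simp only [ellipsoid, mem_inter_iff, mem_ofPred_eq, le_min_iff]
      refine and_congr_left fun _ => ?_
      rw [← Real.log_le_iff_le_exp ht0, Real.le_sqrt (norm_nonneg _) hl.le, le_div_iff₀ hb]
      constructor <;> intro h <;> linarith
    rw [this]
    exact h _ (lt_min (Real.sqrt_pos.2 hl) hr₀) (min_le_right _ _)
  · have : {z | t ≤ Real.exp (-b * ‖T (z - x)‖ ^ 2)} = ∅ := by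
      ext z
      simp only [mem_ofPred_eq, mem_empty_iff_false, iff_false, not_le]
      refine lt_of_le_of_lt (Real.exp_le_one_iff.2 ?_) ht
      nlinarith [sq_nonneg ‖T (z - x)‖]
    rw [this]
    simp

theorem lintegral_gaussian_ellipsoid (T : E ≃L[ℝ] E) (x : E) {b : ℝ} (hb : 0 < b) :
    ∫⁻ z : E, ENNReal.ofReal (Real.exp (-b * ‖T (z - x)‖ ^ 2)) =
      ENNReal.ofReal (|(LinearMap.det (T : E →ₗ[ℝ] E))⁻¹| *
        (Real.pi / b) ^ (Module.finrank ℝ E / 2 : ℝ)) := by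
  have hdet : LinearMap.det (T : E →ₗ[ℝ] E) ≠ 0 := by
    have := LinearEquiv.isUnit_det' T.toLinearEquiv
    exact this.ne_zero
  have hi : Integrable (fun v : E => Real.exp (-b * ‖v‖ ^ 2)) := by
    have := GaussianFourier.integral_rexp_neg_mul_sq_norm (V := E) hb
    -- A non-integrable function has integral 0 by convention, but the value found is positive.
    by_contra hc
    rw [integral_undef hc] at this
    exact (Real.rpow_pos_of_pos (div_pos Real.pi_pos hb) _).ne this
  rw [lintegral_sub_right_eq_self (fun z => ENNReal.ofReal (Real.exp (-b * ‖T z‖ ^ 2))) x]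
  have hmap := Measure.map_linearMap_addHaar_eq_smul_addHaar (μ := (volume : Measure E)) hdet
  have hm : Measurable fun v : E => ENNReal.ofReal (Real.exp (-b * ‖v‖ ^ 2)) :=
    Measurable.ennreal_ofReal (Continuous.measurable (by fun_prop))
  have := lintegral_map (μ := (volume : Measure E)) hm T.continuous.measurable
  rw [← this]
  erw [hmap]
  rw [lintegral_smul_measure, ← ofReal_integral_eq_lintegral_ofReal hi
    (Eventually.of_forall fun z => (Real.exp_pos _).le),
    GaussianFourier.integral_rexp_neg_mul_sq_norm hb, ENNReal.ofReal_mul (abs_nonneg _), smul_eq_mul]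

end Ellipsoid

/-! ### Differentiation of the partition function and of the mean map. -/

namespace ExpFam

variable {d : ℕ} {P₀ : Measure (EuclideanSpace ℝ (Fin d))} {β : EuclideanSpace ℝ (Fin d)}

/-- The norm is at most ∑ |x_i|, the largest of the products ⟨v, x⟩ over the finitely many sign
vectors v. So the integrand is dominated by the sum of the exponentials at the parameters β + δv,
which lie in Γ for small δ. -/
theorem exists_integrable_exp_add_mul_norm (hβ : β ∈ interior (canonicalSpace P₀)) :
    ∃ δ > 0, Integrable (fun x => Real.exp (inner ℝ β x + δ * ‖x‖)) P₀ := by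
  obtain ⟨r, hr, hball⟩ := Metric.mem_nhds_iff.1 (mem_interior_iff_mem_nhds.1 hβ)
  let v : (Fin d → Bool) → EuclideanSpace ℝ (Fin d) :=
    fun s => WithLp.toLp 2 fun i => if s i then 1 else -1
  have hv : ∀ s, ‖v s‖ = Real.sqrt d := by
    intro s
    rw [EuclideanSpace.norm_eq]
    congr 1
    have this' : ∀ i, v s i ^ 2 = 1 := by
      intro i
      by_cases h : s i <;> simp [v, h]
    rw [Finset.sum_congr rfl fun i _ => by rw [Real.norm_eq_abs, sq_abs, this']]
    simp
  have hd0 : 0 < Real.sqrt d + 1 := by positivity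
  refine ⟨r / (2 * (Real.sqrt d + 1)), by positivity, ?_⟩
  set δ := r / (2 * (Real.sqrt d + 1)) with hδ
  have hδ0 : 0 < δ := by positivity
  have hmem : ∀ s, β + δ • v s ∈ canonicalSpace P₀ := by
    intro s
    refine hball ?_
    rw [mem_ball_iff_norm, add_sub_cancel_left, norm_smul, hv, Real.norm_of_nonneg hδ0.le, hδ,
      div_mul_eq_mul_div, div_lt_iff₀ (by positivity)]
    nlinarith
  refine Integrable.mono' (integrable_finsetSum Finset.univ fun s _ => hmem s)
    (Continuous.aestronglyMeasurable (by fun_prop)) (Eventually.of_forall fun x => ?_)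
  rw [Real.norm_of_nonneg (Real.exp_pos _).le]
  let s : Fin d → Bool := fun i => decide (0 ≤ x i)
  refine le_trans ?_ (Finset.single_le_sum
    (f := fun s => Real.exp (inner ℝ (β + δ • v s) x)) (fun s _ => (Real.exp_pos _).le)
    (Finset.mem_univ s))
  rw [Real.exp_le_exp, inner_add_left, inner_smul_left]
  have h1 : inner ℝ (v s) x = ∑ i, |x i| := by
    rw [PiLp.inner_apply]
    refine Finset.sum_congr rfl fun i _ => ?_
    by_cases h : 0 ≤ x i
    · simp [v, s, h, abs_of_nonneg h]
    · simp [v, s, h, abs_of_neg (not_le.1 h)]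
  have h2 : ‖x‖ ≤ ∑ i, |x i| := by
    rw [EuclideanSpace.norm_eq, Real.sqrt_le_left (Finset.sum_nonneg fun i _ => abs_nonneg _)]
    exact Finset.sum_sq_le_sq_sum_of_nonneg fun i _ => abs_nonneg _
  rw [h1]
  simp only [conj_trivial]
  gcongr

theorem exists_pow_mul_exp_le {δ : ℝ} (hδ : 0 < δ) (p : ℕ) :
    ∃ K, 0 ≤ K ∧ ∀ t, 0 ≤ t → t ^ p * Real.exp (δ / 2 * t) ≤ K * Real.exp (δ * t) := by
  refine ⟨p.factorial * (2 / δ) ^ p, by positivity, fun t ht => ?_⟩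
  have h := Real.pow_div_factorial_le_exp (δ / 2 * t) (by positivity) p
  rw [div_le_iff₀ (by positivity), mul_pow] at h
  have h2 : t ^ p ≤ p.factorial * (2 / δ) ^ p * Real.exp (δ / 2 * t) := by
    calc t ^ p = (2 / δ) ^ p * ((δ / 2) ^ p * t ^ p) := by
          rw [← mul_assoc, ← mul_pow, div_mul_div_cancel₀ hδ.ne', div_self two_ne_zero, one_pow, one_mul]
      _ ≤ (2 / δ) ^ p * (Real.exp (δ / 2 * t) * p.factorial) := by gcongr
      _ = _ := by ring
  calc t ^ p * Real.exp (δ / 2 * t)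
      ≤ (p.factorial * (2 / δ) ^ p * Real.exp (δ / 2 * t)) * Real.exp (δ / 2 * t) := by gcongr
    _ = _ := by rw [mul_assoc, ← Real.exp_add]; ring_nf

variable {F : Type*} [NormedAddCommGroup F] [NormedSpace ℝ F]

/-- The dominating function for differentiation under the integral sign: half of the spare exponent
δ absorbs the change of parameter, the other half the power of the norm. -/
theorem exists_integrable_bound (hβ : β ∈ interior (canonicalSpace P₀)) (C : ℝ) (hC : 0 ≤ C)
    (p : ℕ) :
    ∃ ε > 0, ∃ B : EuclideanSpace ℝ (Fin d) → ℝ, Integrable B P₀ ∧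
      ∀ x, ∀ b ∈ Metric.ball β ε, Real.exp (inner ℝ b x) * (C * ‖x‖ ^ p) ≤ B x := by
  obtain ⟨δ, hδ, hint⟩ := exists_integrable_exp_add_mul_norm hβ
  obtain ⟨K, hK, hKb⟩ := exists_pow_mul_exp_le hδ p
  refine ⟨δ / 2, by positivity, _, hint.const_mul (C * K), fun x b hb => ?_⟩
  have h1 : inner ℝ b x ≤ inner ℝ β x + δ / 2 * ‖x‖ := by
    have h := real_inner_le_norm (b - β) x
    rw [mem_ball_iff_norm] at hb
    rw [inner_sub_left] at h
    nlinarith [norm_nonneg x]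
  calc Real.exp (inner ℝ b x) * (C * ‖x‖ ^ p)
      ≤ Real.exp (inner ℝ β x + δ / 2 * ‖x‖) * (C * ‖x‖ ^ p) := by gcongr
    _ = C * Real.exp (inner ℝ β x) * (‖x‖ ^ p * Real.exp (δ / 2 * ‖x‖)) := by
        rw [Real.exp_add]; ring
    _ ≤ C * Real.exp (inner ℝ β x) * (K * Real.exp (δ * ‖x‖)) := by
        exact mul_le_mul_of_nonneg_left (hKb ‖x‖ (norm_nonneg x)) (by positivity)
    _ = _ := by rw [Real.exp_add]; ring

theorem integrable_exp_smul (hβ : β ∈ interior (canonicalSpace P₀))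
    {φ : EuclideanSpace ℝ (Fin d) → F} (hφ : Continuous φ) {C : ℝ} {p : ℕ} (hC : 0 ≤ C)
    (hbound : ∀ x, ‖φ x‖ ≤ C * ‖x‖ ^ p) :
    Integrable (fun x => Real.exp (inner ℝ β x) • φ x) P₀ := by
  obtain ⟨ε, hε, B, hB, hBb⟩ := exists_integrable_bound hβ C hC p
  refine hB.mono' (Continuous.aestronglyMeasurable (by fun_prop)) (Eventually.of_forall fun x => ?_)
  rw [norm_smul, Real.norm_of_nonneg (Real.exp_pos _).le]
  refine le_trans ?_ (hBb x β (Metric.mem_ball_self hε))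
  gcongr
  exact hbound x

/-- Vector values and polynomial growth make the class of integrals closed under differentiation:
the derivative is of the same form with `p + 1` in place of `p`. -/
theorem hasFDerivAt_integral_exp_smul (hβ : β ∈ interior (canonicalSpace P₀))
    {φ : EuclideanSpace ℝ (Fin d) → F} (hφ : Continuous φ) {C : ℝ} {p : ℕ} (hC : 0 ≤ C)
    (hbound : ∀ x, ‖φ x‖ ≤ C * ‖x‖ ^ p) :
    HasFDerivAt (fun b => ∫ x, Real.exp (inner ℝ b x) • φ x ∂P₀)
      (∫ x, Real.exp (inner ℝ β x) • (innerSL ℝ x).smulRight (φ x) ∂P₀) β := by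
  obtain ⟨ε, hε, B, hB, hBb⟩ := exists_integrable_bound hβ C hC (p + 1)
  refine hasFDerivAt_integral_of_dominated_of_fderiv_le (Metric.ball_mem_nhds β hε)
    (F' := fun b x => Real.exp (inner ℝ b x) • (innerSL ℝ x).smulRight (φ x))
    (Eventually.of_forall fun b => Continuous.aestronglyMeasurable (by fun_prop))
    (integrable_exp_smul hβ hφ hC hbound) ?_ (bound := B) ?_ hB ?_
  · have := secondCountableTopologyEither_of_left (EuclideanSpace ℝ (Fin d))
      (EuclideanSpace ℝ (Fin d) →L[ℝ] F)
    have hexp : Continuous fun x : EuclideanSpace ℝ (Fin d) => Real.exp (inner ℝ β x) := by fun_prop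
    refine Continuous.aestronglyMeasurable (hexp.smul ?_)
    exact ((ContinuousLinearMap.smulRightL ℝ (EuclideanSpace ℝ (Fin d)) F).continuous₂).comp
      ((innerSL ℝ).continuous.prodMk hφ)
  · refine Eventually.of_forall fun x b hb => ?_
    rw [norm_smul, Real.norm_of_nonneg (Real.exp_pos _).le]
    refine le_trans ?_ (hBb x b hb)
    gcongr
    rw [ContinuousLinearMap.norm_smulRight_apply, innerSL_apply_norm]
    calc ‖x‖ * ‖φ x‖ ≤ ‖x‖ * (C * ‖x‖ ^ p) := by gcongr; exact hbound x
      _ = _ := by ring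
  · refine Eventually.of_forall fun x b _ => ?_
    have h1 : HasFDerivAt (fun b : EuclideanSpace ℝ (Fin d) => Real.exp (inner ℝ b x))
        (Real.exp (inner ℝ b x) • innerSL ℝ x) b := by
      have h := ((innerSL ℝ x).hasFDerivAt (x := b)).exp
      simpa only [innerSL_apply_apply, real_inner_comm] using h
    have h2 := h1.smul_const (φ x)
    exact h2.congr_fderiv (by ext; simp [smul_smul])

/-- The derivative, being an integral of the same form, is itself differentiable and hence
continuous. Strictness is what the inverse function theorem needs. -/
theorem hasStrictFDerivAt_integral_exp_smul (hβ : β ∈ interior (canonicalSpace P₀))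
    {φ : EuclideanSpace ℝ (Fin d) → F} (hφ : Continuous φ) {C : ℝ} {p : ℕ} (hC : 0 ≤ C)
    (hbound : ∀ x, ‖φ x‖ ≤ C * ‖x‖ ^ p) :
    HasStrictFDerivAt (fun b => ∫ x, Real.exp (inner ℝ b x) • φ x ∂P₀)
      (∫ x, Real.exp (inner ℝ β x) • (innerSL ℝ x).smulRight (φ x) ∂P₀) β := by
  refine hasStrictFDerivAt_of_hasFDerivAt_of_continuousAt
    (f' := fun b => ∫ x, Real.exp (inner ℝ b x) • (innerSL ℝ x).smulRight (φ x) ∂P₀) ?_ ?_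
  · filter_upwards [isOpen_interior.mem_nhds hβ] with b hb
    exact hasFDerivAt_integral_exp_smul hb hφ hC hbound
  · refine (hasFDerivAt_integral_exp_smul (φ := fun x => (innerSL ℝ x).smulRight (φ x))
      (C := C) (p := p + 1) hβ ?_ hC fun x => ?_).continuousAt
    · exact ((ContinuousLinearMap.smulRightL ℝ (EuclideanSpace ℝ (Fin d)) F).continuous₂).comp
        ((innerSL ℝ).continuous.prodMk hφ)
    · rw [ContinuousLinearMap.norm_smulRight_apply, innerSL_apply_norm]
      calc ‖x‖ * ‖φ x‖ ≤ ‖x‖ * (C * ‖x‖ ^ p) := by gcongr; exact hbound x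
        _ = _ := by ring

/-- The mean value `Z(β)⁻¹ ∫ exp(β·x) x dP₀(x)` of the element `P_β`. -/
noncomputable def meanMap (P₀ : Measure (EuclideanSpace ℝ (Fin d)))
    (β : EuclideanSpace ℝ (Fin d)) : EuclideanSpace ℝ (Fin d) :=
  (partition P₀ β)⁻¹ • ∫ x, Real.exp (inner ℝ β x) • x ∂P₀

/-- The covariance operator of the element `P_β`. -/
noncomputable def covOp (P₀ : Measure (EuclideanSpace ℝ (Fin d))) (β : EuclideanSpace ℝ (Fin d)) :
    EuclideanSpace ℝ (Fin d) →L[ℝ] EuclideanSpace ℝ (Fin d) :=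
  (partition P₀ β)⁻¹ • (∫ x, Real.exp (inner ℝ β x) • (innerSL ℝ x).smulRight x ∂P₀) -
    (innerSL ℝ (meanMap P₀ β)).smulRight (meanMap P₀ β)

theorem hasStrictFDerivAt_partition (hβ : β ∈ interior (canonicalSpace P₀)) :
    HasStrictFDerivAt (partition P₀)
      (innerSL ℝ (∫ x, Real.exp (inner ℝ β x) • x ∂P₀)) β := by
  have h := hasStrictFDerivAt_integral_exp_smul (φ := fun _ => (1 : ℝ)) (C := 1) (p := 0) hβ
    continuous_const zero_le_one (by simp)
  have h1 := integrable_exp_smul (φ := fun x => x) (C := 1) (p := 1) hβ continuous_id zero_le_one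
    (by simp)
  have h2 := integrable_exp_smul (φ := fun x => (innerSL ℝ x).smulRight (1 : ℝ)) (C := 1) (p := 1)
    hβ (((ContinuousLinearMap.smulRightL ℝ (EuclideanSpace ℝ (Fin d)) ℝ).continuous₂).comp
        ((innerSL ℝ).continuous.prodMk continuous_const)) zero_le_one
    (by intro x; simp [ContinuousLinearMap.norm_smulRight_apply])
  convert! h using 1
  · funext b
    simp [partition]
  · ext k
    rw [ContinuousLinearMap.integral_apply h2, innerSL_apply_apply, real_inner_comm,
      ← integral_inner h1]
    refine integral_congr_ae (Eventually.of_forall fun x => ?_)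
    simp [inner_smul_right, real_inner_comm]

theorem integral_element (f : EuclideanSpace ℝ (Fin d) → F) :
    ∫ x, f x ∂(element P₀ β) = (partition P₀ β)⁻¹ • ∫ x, Real.exp (inner ℝ β x) • f x ∂P₀ := by
  rw [element_eq_tilted, integral_tilted, ← integral_smul]
  refine integral_congr_ae (Eventually.of_forall fun x => ?_)
  simp only [smul_smul, partition]
  congr 1
  rw [div_eq_inv_mul]

theorem integrable_element (hβ : β ∈ interior (canonicalSpace P₀))
    {φ : EuclideanSpace ℝ (Fin d) → F} (hφ : Continuous φ) {C : ℝ} {p : ℕ} (hC : 0 ≤ C)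
    (hbound : ∀ x, ‖φ x‖ ≤ C * ‖x‖ ^ p) : Integrable φ (element P₀ β) := by
  rw [element_eq_tilted, integrable_tilted_iff (show β ∈ canonicalSpace P₀ from interior_subset hβ)]
  exact integrable_exp_smul hβ hφ hC hbound

theorem hasMean_meanMap (hβ : β ∈ interior (canonicalSpace P₀)) :
    HasMean P₀ β (meanMap P₀ β) :=
  ⟨interior_subset hβ,
    integrable_element (φ := fun x => x) (C := 1) (p := 1) hβ continuous_id zero_le_one (by simp),
    integral_element _⟩

theorem memLp_inner_element (hβ : β ∈ interior (canonicalSpace P₀))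
    (h : EuclideanSpace ℝ (Fin d)) : MemLp (fun x => inner ℝ h x) 2 (element P₀ β) := by
  rw [memLp_two_iff_integrable_sq (Continuous.aestronglyMeasurable (by fun_prop))]
  refine integrable_element (φ := fun x => (inner ℝ h x) ^ 2) (C := ‖h‖ ^ 2) (p := 2) hβ
    (by fun_prop) (by positivity) fun x => ?_
  rw [norm_pow, ← mul_pow]
  gcongr
  exact norm_inner_le_norm h x

variable [IsProbabilityMeasure P₀]

theorem partition_pos (hβ : β ∈ canonicalSpace P₀) : 0 < partition P₀ β := integral_exp_pos hβ

theorem hasStrictFDerivAt_meanMap (hβ : β ∈ interior (canonicalSpace P₀)) :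
    HasStrictFDerivAt (meanMap P₀) (covOp P₀ β) β := by
  have h1 := hasStrictFDerivAt_integral_exp_smul (φ := fun x => x) (C := 1) (p := 1) hβ
    continuous_id zero_le_one (by simp)
  have hZ := partition_pos (interior_subset hβ)
  have h0 := (hasStrictDerivAt_inv hZ.ne').comp_hasStrictFDerivAt β (hasStrictFDerivAt_partition hβ)
  have h := h0.smul h1
  refine h.congr_fderiv ?_
  ext1 k
  simp only [covOp, meanMap, add_apply, sub_apply,
    smul_apply, ContinuousLinearMap.smulRight_apply, innerSL_apply_apply,
    Function.comp_apply, inner_smul_left, smul_smul, conj_trivial, smul_eq_mul]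
  rw [sub_eq_add_neg, ← neg_smul]
  congr 2
  field_simp

theorem hasStrictFDerivAt_log_partition (hβ : β ∈ interior (canonicalSpace P₀)) :
    HasStrictFDerivAt (fun b => Real.log (partition P₀ b)) (innerSL ℝ (meanMap P₀ β)) β := by
  have h := (hasStrictFDerivAt_partition hβ).log (partition_pos (interior_subset hβ)).ne'
  refine h.congr_fderiv ?_
  ext k
  simp [meanMap]

theorem isProbabilityMeasure_element (hβ : β ∈ canonicalSpace P₀) :
    IsProbabilityMeasure (element P₀ β) := by
  rw [element_eq_tilted]; exact isProbabilityMeasure_tilted hβ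

theorem inner_covOp (hβ : β ∈ interior (canonicalSpace P₀)) (h k : EuclideanSpace ℝ (Fin d)) :
    inner ℝ h (covOp P₀ β k) =
      ProbabilityTheory.covariance (fun x => inner ℝ h x) (fun x => inner ℝ k x) (element P₀ β) := by
  have := isProbabilityMeasure_element (interior_subset hβ)
  have hm := hasMean_meanMap hβ
  have hi : ∀ h, ∫ x, inner ℝ h x ∂(element P₀ β) = inner ℝ h (meanMap P₀ β) := fun h => by
    rw [← hm.2.2]; exact integral_inner hm.2.1 h
  rw [ProbabilityTheory.covariance_eq_sub (memLp_inner_element hβ h) (memLp_inner_element hβ k),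
    hi, hi, covOp, sub_apply, inner_sub_right]
  congr 1
  · have h2 := integrable_exp_smul (φ := fun x => (innerSL ℝ x).smulRight x) (C := 1) (p := 2)
      hβ (((ContinuousLinearMap.smulRightL ℝ (EuclideanSpace ℝ (Fin d)) _).continuous₂).comp
        ((innerSL ℝ).continuous.prodMk continuous_id)) zero_le_one
      (by intro x; simp [ContinuousLinearMap.norm_smulRight_apply, sq])
    rw [integral_element, smul_apply, inner_smul_right,
      ContinuousLinearMap.integral_apply h2, ← integral_inner (h2.apply_continuousLinearMap k),
      smul_eq_mul]
    congr 1
    refine integral_congr_ae (Eventually.of_forall fun x => ?_)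
    simp [inner_smul_right, real_inner_comm]
    ring
  · simp [inner_smul_right, real_inner_comm]
    ring

end ExpFam

/-! ### Nondegeneracy, inversion of the mean map, and the mean value range. -/

namespace ExpFam

variable {d : ℕ} {P₀ : Measure (EuclideanSpace ℝ (Fin d))} {β : EuclideanSpace ℝ (Fin d)}

theorem convex_canonicalSpace : Convex ℝ (canonicalSpace P₀) := by
  intro β hβ γ hγ a b ha hb hab
  refine Integrable.mono' ((Integrable.const_mul hβ a).add (Integrable.const_mul hγ b))
    (Continuous.aestronglyMeasurable (by fun_prop)) (Eventually.of_forall fun x => ?_)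
  rw [Real.norm_of_nonneg (Real.exp_pos _).le]
  have h := convexOn_exp.2 (mem_univ (inner ℝ β x)) (mem_univ (inner ℝ γ x)) ha hb hab
  simpa [inner_add_left, inner_smul_left] using h

theorem tendsto_add_smul_nhdsGT (y u : EuclideanSpace ℝ (Fin d)) :
    Tendsto (fun t : ℝ => y + t • u) (𝓝[>] 0) (𝓝 y) := by
  have : Tendsto (fun t : ℝ => y + t • u) (𝓝 0) (𝓝 (y + (0 : ℝ) • u)) :=
    Continuous.tendsto (by fun_prop) 0
  rw [zero_smul, add_zero] at this
  exact this.mono_left nhdsWithin_le_nhds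

theorem eq_zero_of_inner_eq_of_interior_nonempty {C : Set (EuclideanSpace ℝ (Fin d))}
    (hC : (interior C).Nonempty) {u : EuclideanSpace ℝ (Fin d)} {a : ℝ}
    (h : ∀ x ∈ C, inner ℝ u x = a) : u = 0 := by
  obtain ⟨y, hy⟩ := hC
  have hy' := mem_interior_iff_mem_nhds.1 hy
  obtain ⟨t, ht1, ht2⟩ := (((tendsto_add_smul_nhdsGT y u).eventually hy').and self_mem_nhdsWithin).exists
  have ht2 : 0 < t := ht2
  have h1 := h _ (mem_of_mem_nhds hy')
  have h2 := h _ ht1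
  rw [inner_add_right, h1, inner_smul_right, add_eq_left] at h2
  exact inner_self_eq_zero.1 ((mul_eq_zero.1 h2).resolve_left ht2.ne')

theorem eq_zero_of_measure_hyperplane (hcc : (interior (convexCore P₀)).Nonempty)
    {u : EuclideanSpace ℝ (Fin d)} {a : ℝ} (h : P₀ {x | inner ℝ u x = a} = 1) : u = 0 := by
  refine eq_zero_of_inner_eq_of_interior_nonempty hcc (a := a) fun x hx => ?_
  refine hx {x | inner ℝ u x = a} ⟨?_, ?_, h⟩
  · exact convex_hyperplane (innerSL ℝ u).toLinearMap.isLinear a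
  · exact measurableSet_eq_fun (Continuous.measurable (by fun_prop)) measurable_const

variable [IsProbabilityMeasure P₀]

theorem zero_mem_canonicalSpace : (0 : EuclideanSpace ℝ (Fin d)) ∈ canonicalSpace P₀ := by
  simp [canonicalSpace]

theorem eq_zero_of_ae_inner_eq (hcc : (interior (convexCore P₀)).Nonempty)
    {u : EuclideanSpace ℝ (Fin d)} {a : ℝ} (h : ∀ᵐ x ∂P₀, inner ℝ u x = a) : u = 0 :=
  eq_zero_of_measure_hyperplane hcc ((mem_ae_iff_prob_eq_one
    (measurableSet_eq_fun (Continuous.measurable (by fun_prop)) measurable_const)).1 h)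

theorem eq_zero_of_ae_element_inner_eq (hcc : (interior (convexCore P₀)).Nonempty)
    (hβ : β ∈ canonicalSpace P₀) {u : EuclideanSpace ℝ (Fin d)} {a : ℝ}
    (h : ∀ᵐ x ∂(element P₀ β), inner ℝ u x = a) : u = 0 := by
  refine eq_zero_of_ae_inner_eq hcc (a := a) ?_
  rw [element_eq_tilted] at h
  exact (absolutelyContinuous_tilted hβ).ae_le h

/-- Zero variance would make a linear functional almost surely constant under P_β, hence under the
equivalent measure P₀. A hyperplane would then contain the convex core, which has interior points.
-/
theorem inner_covOp_self_pos (hcc : (interior (convexCore P₀)).Nonempty)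
    (hβ : β ∈ interior (canonicalSpace P₀)) {h : EuclideanSpace ℝ (Fin d)} (hh : h ≠ 0) :
    0 < inner ℝ h (covOp P₀ β h) := by
  have := isProbabilityMeasure_element (interior_subset hβ)
  have hL := memLp_inner_element hβ h
  rw [inner_covOp hβ, ProbabilityTheory.covariance_self hL.aemeasurable]
  refine lt_of_le_of_ne (ProbabilityTheory.variance_nonneg _ _) fun h0 => hh ?_
  exact eq_zero_of_ae_element_inner_eq hcc (interior_subset hβ)
    (ProbabilityTheory.ae_eq_integral_of_variance_eq_zero hL h0.symm)

theorem exists_covOp_equiv (hcc : (interior (convexCore P₀)).Nonempty)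
    (hβ : β ∈ interior (canonicalSpace P₀)) :
    ∃ e : EuclideanSpace ℝ (Fin d) ≃L[ℝ] EuclideanSpace ℝ (Fin d),
      (e : EuclideanSpace ℝ (Fin d) →L[ℝ] EuclideanSpace ℝ (Fin d)) = covOp P₀ β := by
  have hinj : Function.Injective (covOp P₀ β).toLinearMap := by
    refine (injective_iff_map_eq_zero _).2 fun h h0 => ?_
    by_contra hne
    have := inner_covOp_self_pos hcc hβ hne
    rw [show covOp P₀ β h = 0 from h0, inner_zero_right] at this
    exact lt_irrefl _ this
  refine ⟨(LinearEquiv.ofInjectiveEndo _ hinj).toContinuousLinearEquiv, ?_⟩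
  ext1 x
  rfl

/-- The element of the family with mean `y` is the unique maximum likelihood element at `y`. -/
theorem log_density_lt (hcc : (interior (convexCore P₀)).Nonempty)
    {γ y : EuclideanSpace ℝ (Fin d)} (hβ : HasMean P₀ β y) (hγ : γ ∈ canonicalSpace P₀)
    (hne : γ ≠ β) : Real.log (density P₀ γ y) < Real.log (density P₀ β y) := by
  have hpβ := isProbabilityMeasure_element hβ.1
  have hpγ := isProbabilityMeasure_element hγ
  obtain ⟨h0, h1⟩ := klDiv_element hβ hγ
  refine lt_of_le_of_ne (sub_nonneg.1 h0) fun heq => hne ?_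
  rw [heq, sub_self, ENNReal.ofReal_zero, InformationTheory.klDiv_eq_zero_iff] at h1
  have h2 := log_rnDeriv_tilted_left_self (μ := P₀) (f := fun x => inner ℝ β x) hβ.1
  have h3 := log_rnDeriv_tilted_left_self (μ := P₀) (f := fun x => inner ℝ γ x) hγ
  rw [← element_eq_tilted] at h2 h3
  rw [h1] at h2
  refine sub_eq_zero.1 (eq_zero_of_ae_inner_eq hcc (u := γ - β)
    (a := Real.log (partition P₀ γ) - Real.log (partition P₀ β)) ?_)
  filter_upwards [h2, h3] with x hx2 hx3
  rw [hx2] at hx3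
  simp only [partition, inner_sub_left]
  linarith

theorem log_density_le {γ y : EuclideanSpace ℝ (Fin d)} (hβ : HasMean P₀ β y)
    (hγ : γ ∈ canonicalSpace P₀) : Real.log (density P₀ γ y) ≤ Real.log (density P₀ β y) :=
  sub_nonneg.1 (klDiv_element hβ hγ).1

theorem HasMean.unique (hcc : (interior (convexCore P₀)).Nonempty)
    {γ y : EuclideanSpace ℝ (Fin d)} (hβ : HasMean P₀ β y) (hγ : HasMean P₀ γ y) : γ = β := by
  by_contra hne
  exact lt_asymm (log_density_lt hcc hβ hγ.1 hne) (log_density_lt hcc hγ hβ.1 (Ne.symm hne))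

theorem betaHat_eq (hcc : (interior (convexCore P₀)).Nonempty) {y : EuclideanSpace ℝ (Fin d)}
    (hβ : HasMean P₀ β y) : betaHat P₀ y = β :=
  hβ.unique hcc (hasMean_betaHat ⟨β, hβ⟩)

theorem betaHat_mem_canonicalSpace (y : EuclideanSpace ℝ (Fin d)) :
    betaHat P₀ y ∈ canonicalSpace P₀ := by
  by_cases h : ∃ β, HasMean P₀ β y
  · exact (hasMean_betaHat h).1
  · rw [betaHat, dif_neg h]
    exact zero_mem_canonicalSpace

theorem exists_inner_le_of_notMem_interior {C : Set (EuclideanSpace ℝ (Fin d))} (hC : Convex ℝ C)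
    (hne : (interior C).Nonempty) {x : EuclideanSpace ℝ (Fin d)} (hx : x ∉ interior C) :
    ∃ u : EuclideanSpace ℝ (Fin d), u ≠ 0 ∧ ∀ y ∈ C, inner ℝ u y ≤ inner ℝ u x := by
  obtain ⟨f, hf, hfx⟩ := geometric_hahn_banach_of_nonempty_interior_point hC hx hne
  refine ⟨(InnerProductSpace.toDual ℝ _).symm f, by simpa using hf, fun y hy => ?_⟩
  simpa using hfx y hy

/-- If β̂(y) were on the boundary of Γ, let u be an outer normal there and β' the parameter with
mean y + tu. Comparing the two likelihoods at y and at y + tu shows that β' ≠ β̂(y) would lie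
strictly beyond the supporting hyperplane; and β' = β̂(y) would force u = 0. -/
theorem betaHat_mem_interior (hΓ : (interior (canonicalSpace P₀)).Nonempty)
    (hcc : (interior (convexCore P₀)).Nonempty) {y : EuclideanSpace ℝ (Fin d)}
    (hy : y ∈ interior (meanRange P₀)) : betaHat P₀ y ∈ interior (canonicalSpace P₀) := by
  by_contra hcon
  have hm := hasMean_betaHat (interior_subset hy)
  obtain ⟨u, hu, hle⟩ := exists_inner_le_of_notMem_interior convex_canonicalSpace hΓ hcon
  obtain ⟨t, ht1, ht2⟩ := (((tendsto_add_smul_nhdsGT y u).eventually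
    (mem_interior_iff_mem_nhds.1 hy)).and self_mem_nhdsWithin).exists
  have ht2 : 0 < t := ht2
  obtain ⟨β', hβ'⟩ := ht1
  have heq : betaHat P₀ y = β' := by
    by_contra hne
    have h1 := log_density_lt hcc hβ' hm.1 hne
    have h2 := log_density_le hm hβ'.1
    rw [log_density hm.1, log_density hβ'.1] at h1 h2
    simp only [inner_add_right, inner_smul_right] at h1
    have h3 := hle _ hβ'.1
    rw [real_inner_comm, real_inner_comm (betaHat P₀ y)] at h3
    nlinarith
  have h4 := hβ'.2.2
  rw [← heq, hm.2.2, eq_comm, add_eq_left] at h4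
  exact hu ((smul_eq_zero.1 h4).resolve_left ht2.ne')

theorem meanMap_betaHat (hΓ : (interior (canonicalSpace P₀)).Nonempty)
    (hcc : (interior (convexCore P₀)).Nonempty) {y : EuclideanSpace ℝ (Fin d)}
    (hy : y ∈ interior (meanRange P₀)) : meanMap P₀ (betaHat P₀ y) = y := by
  rw [← (hasMean_meanMap (betaHat_mem_interior hΓ hcc hy)).2.2]
  exact (hasMean_betaHat (interior_subset hy)).2.2

/-- By uniqueness of the parameter, `betaHat` is a left inverse of the mean map near β, so the
inverse function theorem applies to it. -/
theorem hasStrictFDerivAt_betaHat_meanMap (hcc : (interior (convexCore P₀)).Nonempty)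
    (hβ : β ∈ interior (canonicalSpace P₀))
    {e : EuclideanSpace ℝ (Fin d) ≃L[ℝ] EuclideanSpace ℝ (Fin d)}
    (he : (e : EuclideanSpace ℝ (Fin d) →L[ℝ] EuclideanSpace ℝ (Fin d)) = covOp P₀ β) :
    HasStrictFDerivAt (betaHat P₀)
      (e.symm : EuclideanSpace ℝ (Fin d) →L[ℝ] EuclideanSpace ℝ (Fin d)) (meanMap P₀ β) := by
  have h : HasStrictFDerivAt (meanMap P₀)
      (e : EuclideanSpace ℝ (Fin d) →L[ℝ] EuclideanSpace ℝ (Fin d)) β :=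
    he ▸ hasStrictFDerivAt_meanMap hβ
  refine h.to_local_left_inverse ?_
  filter_upwards [isOpen_interior.mem_nhds hβ] with b hb
  exact betaHat_eq hcc (hasMean_meanMap hb)

theorem meanMap_mem_interior (hcc : (interior (convexCore P₀)).Nonempty)
    (hβ : β ∈ interior (canonicalSpace P₀)) : meanMap P₀ β ∈ interior (meanRange P₀) := by
  obtain ⟨e, he⟩ := exists_covOp_equiv hcc hβ
  have h : HasStrictFDerivAt (meanMap P₀)
      (e : EuclideanSpace ℝ (Fin d) →L[ℝ] EuclideanSpace ℝ (Fin d)) β :=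
    he ▸ hasStrictFDerivAt_meanMap hβ
  rw [mem_interior_iff_mem_nhds, ← h.map_nhds_eq_of_equiv, mem_map]
  filter_upwards [isOpen_interior.mem_nhds hβ] with b hb
  exact ⟨b, hasMean_meanMap hb⟩

theorem hasStrictFDerivAt_betaHat (hΓ : (interior (canonicalSpace P₀)).Nonempty)
    (hcc : (interior (convexCore P₀)).Nonempty) {y : EuclideanSpace ℝ (Fin d)}
    (hy : y ∈ interior (meanRange P₀))
    {e : EuclideanSpace ℝ (Fin d) ≃L[ℝ] EuclideanSpace ℝ (Fin d)}
    (he : (e : EuclideanSpace ℝ (Fin d) →L[ℝ] EuclideanSpace ℝ (Fin d)) =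
      covOp P₀ (betaHat P₀ y)) :
    HasStrictFDerivAt (betaHat P₀)
      (e.symm : EuclideanSpace ℝ (Fin d) →L[ℝ] EuclideanSpace ℝ (Fin d)) y := by
  have h := hasStrictFDerivAt_betaHat_meanMap hcc (betaHat_mem_interior hΓ hcc hy) he
  rwa [meanMap_betaHat hΓ hcc hy] at h

theorem continuousAt_betaHat (hΓ : (interior (canonicalSpace P₀)).Nonempty)
    (hcc : (interior (convexCore P₀)).Nonempty) {y : EuclideanSpace ℝ (Fin d)}
    (hy : y ∈ interior (meanRange P₀)) : ContinuousAt (betaHat P₀) y := by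
  obtain ⟨e, he⟩ := exists_covOp_equiv hcc (betaHat_mem_interior hΓ hcc hy)
  exact (hasStrictFDerivAt_betaHat hΓ hcc hy he).continuousAt

/-- The convex set C need not be closed, so separation only gives ⟨u, ·⟩ ≤ ⟨u, y⟩ on C. As y is the
mean, equality then holds almost surely, which nondegeneracy forbids. -/
theorem meanRange_subset_convexCore (hcc : (interior (convexCore P₀)).Nonempty) :
    meanRange P₀ ⊆ convexCore P₀ := by
  rintro y ⟨β, hβ, hint, hy⟩ C ⟨hC, hCm, hC1⟩
  have hp := isProbabilityMeasure_element hβ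
  by_contra hyC
  have hCi : (interior C).Nonempty := hcc.mono (interior_mono (sInter_subset_of_mem
    (show C ∈ {C | Convex ℝ C ∧ MeasurableSet C ∧ P₀ C = 1} from ⟨hC, hCm, hC1⟩)))
  obtain ⟨u, hu, hle⟩ := exists_inner_le_of_notMem_interior hC hCi
    (fun h => hyC (interior_subset h))
  have hae : ∀ᵐ x ∂(element P₀ β), x ∈ C := by
    rw [element_eq_tilted]
    exact (tilted_absolutelyContinuous _ _).ae_le ((mem_ae_iff_prob_eq_one hCm).2 hC1)
  have hi : Integrable (fun x => inner ℝ u y - inner ℝ u x) (element P₀ β) :=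
    (integrable_const _).sub (hint.const_inner u)
  have h0 : ∫ x, (inner ℝ u y - inner ℝ u x) ∂(element P₀ β) = 0 := by
    rw [integral_sub (integrable_const _) (hint.const_inner u), integral_inner hint u, hy]
    simp
  rw [integral_eq_zero_iff_of_nonneg_ae (hae.mono fun x hx => sub_nonneg.2 (hle x hx)) hi] at h0
  refine hu (eq_zero_of_ae_element_inner_eq hcc hβ (a := inner ℝ u y) ?_)
  filter_upwards [h0] with x hx
  exact (sub_eq_zero.1 hx).symm

theorem interior_meanRange_subset (hcc : (interior (convexCore P₀)).Nonempty) :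
    interior (meanRange P₀) ⊆ interior (convexCore P₀) :=
  interior_mono (meanRange_subset_convexCore hcc)

end ExpFam

/-! ### Whitening by the covariance matrix and lower bounds for the divergence. -/

open scoped MatrixOrder ComplexOrder in
/-- A positive definite quadratic form is a Euclidean norm after a linear change of variables,
here in the dual form. -/
theorem Matrix.PosDef.exists_equiv_norm_sq {d : ℕ} {M : Matrix (Fin d) (Fin d) ℝ} (hM : M.PosDef) :
    ∃ T : EuclideanSpace ℝ (Fin d) ≃L[ℝ] EuclideanSpace ℝ (Fin d),
      |(LinearMap.det (T : EuclideanSpace ℝ (Fin d) →ₗ[ℝ] EuclideanSpace ℝ (Fin d)))⁻¹| =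
        Real.sqrt M.det ∧
      ∀ v, ‖T (Matrix.toEuclideanLin M v)‖ ^ 2 = inner ℝ v (Matrix.toEuclideanLin M v) := by
  obtain ⟨B, hB⟩ := CStarAlgebra.nonneg_iff_eq_star_mul_self.mp hM.posSemidef.nonneg
  rw [Matrix.star_eq_conjTranspose] at hB
  have hdetM : M.det = B.det ^ 2 := by
    rw [hB, Matrix.det_mul, Matrix.det_conjTranspose]; simp [sq]
  have hB0 : B.det ≠ 0 := by
    intro h
    have := hM.det_pos
    rw [hdetM, h] at this
    simp at this
  have hdet : LinearMap.det (Matrix.toEuclideanLin B.conjTranspose) = B.det := by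
    rw [Matrix.toEuclideanLin_eq_toLin_orthonormal, LinearMap.det_toLin, Matrix.det_conjTranspose]
    simp
  -- With S = Bᴴ one has M = S B, hence S⁻¹ M v = B v and ‖B v‖² = ⟨v, M v⟩. The required map is
  -- S⁻¹.
  let S := (LinearMap.equivOfDetNeZero _ (hdet ▸ hB0)).toContinuousLinearEquiv
  have hS : (S : EuclideanSpace ℝ (Fin d) →ₗ[ℝ] EuclideanSpace ℝ (Fin d)) =
      Matrix.toEuclideanLin B.conjTranspose := by
    ext1 x; rfl
  have hmul : ∀ v, Matrix.toEuclideanLin M v = S (Matrix.toEuclideanLin B v) := by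
    intro v
    change _ = Matrix.toEuclideanLin B.conjTranspose (Matrix.toEuclideanLin B v)
    rw [hB, Matrix.toLpLin_mul_same]
    rfl
  refine ⟨S.symm, ?_, fun v => ?_⟩
  · have : LinearMap.det (S.symm : EuclideanSpace ℝ (Fin d) →ₗ[ℝ] EuclideanSpace ℝ (Fin d)) =
        (LinearMap.det (S : EuclideanSpace ℝ (Fin d) →ₗ[ℝ] EuclideanSpace ℝ (Fin d)))⁻¹ :=
      LinearEquiv.det_coe_symm S.toLinearEquiv
    rw [this, inv_inv, hS, hdet, hdetM, Real.sqrt_sq_eq_abs]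
  · rw [hmul, ContinuousLinearEquiv.symm_apply_apply, ← real_inner_self_eq_norm_sq]
    change _ = inner ℝ v (Matrix.toEuclideanLin B.conjTranspose (Matrix.toEuclideanLin B v))
    rw [Matrix.toEuclideanLin_conjTranspose_eq_adjoint, LinearMap.adjoint_inner_right]

namespace ExpFam

variable {d : ℕ} {P₀ : Measure (EuclideanSpace ℝ (Fin d))} {β : EuclideanSpace ℝ (Fin d)}

variable [IsProbabilityMeasure P₀]

theorem toEuclideanLin_covMatrix {x : EuclideanSpace ℝ (Fin d)}
    (hβ : betaHat P₀ x ∈ interior (canonicalSpace P₀)) :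
    Matrix.toEuclideanLin (covMatrix P₀ x) = (covOp P₀ (betaHat P₀ x)).toLinearMap := by
  have h : ∀ i j, covMatrix P₀ x i j = inner ℝ (EuclideanSpace.single i (1 : ℝ))
      (covOp P₀ (betaHat P₀ x) (EuclideanSpace.single j 1)) := by
    intro i j
    rw [inner_covOp hβ]
    simp [covMatrix, EuclideanSpace.inner_single_left]
  refine (EuclideanSpace.basisFun (Fin d) ℝ).toBasis.ext fun j => ?_
  ext i
  simpa [EuclideanSpace.inner_single_left] using h i j

theorem posDef_covMatrix (hcc : (interior (convexCore P₀)).Nonempty)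
    {x : EuclideanSpace ℝ (Fin d)} (hβ : betaHat P₀ x ∈ interior (canonicalSpace P₀)) :
    (covMatrix P₀ x).PosDef := by
  refine Matrix.PosDef.of_dotProduct_mulVec_pos ?_ fun v hv => ?_
  · ext i j
    simp [covMatrix, ProbabilityTheory.covariance_comm]
  · have h := inner_covOp_self_pos hcc hβ (h := WithLp.toLp 2 v) (by simpa using hv)
    rw [← ContinuousLinearMap.coe_coe, ← toEuclideanLin_covMatrix hβ] at h
    simpa [PiLp.inner_apply, dotProduct, mul_comm] using h

/-- A linear change of variables that turns the inverse covariance form into the square norm. -/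
theorem exists_whitening (hcc : (interior (convexCore P₀)).Nonempty)
    {x : EuclideanSpace ℝ (Fin d)} (hβ : betaHat P₀ x ∈ interior (canonicalSpace P₀)) :
    ∃ T : EuclideanSpace ℝ (Fin d) ≃L[ℝ] EuclideanSpace ℝ (Fin d),
      |(LinearMap.det (T : EuclideanSpace ℝ (Fin d) →ₗ[ℝ] EuclideanSpace ℝ (Fin d)))⁻¹| =
        Real.sqrt (covMatrix P₀ x).det ∧
      ∀ v, ‖T (covOp P₀ (betaHat P₀ x) v)‖ ^ 2 = inner ℝ v (covOp P₀ (betaHat P₀ x) v) := by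
  obtain ⟨T, hT, h⟩ := (posDef_covMatrix hcc hβ).exists_equiv_norm_sq
  refine ⟨T, hT, fun v => ?_⟩
  rw [toEuclideanLin_covMatrix hβ] at h
  exact h v

/-- The divergence of `P_β` from `P_γ` in canonical parameters. -/
noncomputable def bregman (P₀ : Measure (EuclideanSpace ℝ (Fin d)))
    (β γ : EuclideanSpace ℝ (Fin d)) : ℝ :=
  Real.log (partition P₀ γ) - Real.log (partition P₀ β) - inner ℝ (meanMap P₀ β) (γ - β)

theorem bregman_eq (hβ : β ∈ canonicalSpace P₀) {γ : EuclideanSpace ℝ (Fin d)}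
    (hγ : γ ∈ canonicalSpace P₀) :
    bregman P₀ β γ =
      Real.log (density P₀ β (meanMap P₀ β)) - Real.log (density P₀ γ (meanMap P₀ β)) := by
  rw [log_density hβ, log_density hγ, bregman, inner_sub_right, real_inner_comm β,
    real_inner_comm γ]
  ring

theorem exists_bregman_ge_quadratic (hβ : β ∈ interior (canonicalSpace P₀)) {ε : ℝ} (hε : 0 < ε) :
    ∃ r > 0, ∀ γ ∈ Metric.ball β r, γ ∈ interior (canonicalSpace P₀) ∧
      (inner ℝ (γ - β) (covOp P₀ β (γ - β)) - ε * ‖γ - β‖ ^ 2) / 2 ≤ bregman P₀ β γ := by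
  have hlo := (hasStrictFDerivAt_meanMap hβ).hasFDerivAt.isLittleO.def hε
  obtain ⟨r, hr, hball⟩ := Metric.mem_nhds_iff.1
    (Filter.inter_mem (isOpen_interior.mem_nhds hβ) hlo)
  refine ⟨r, hr, fun γ hγ => ⟨(hball hγ).1, ?_⟩⟩
  set h := γ - β with hh
  have hmem : ∀ t ∈ Icc (0 : ℝ) 1, β + t • h ∈ Metric.ball β r := by
    intro t ht
    rw [mem_ball_iff_norm] at hγ ⊢
    rw [add_sub_cancel_left, norm_smul, Real.norm_of_nonneg ht.1]
    nlinarith [norm_nonneg h, ht.2]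
  set q := inner ℝ h (covOp P₀ β h) - ε * ‖h‖ ^ 2 with hq
  -- The gradient of log Z is the mean map, so the linear approximation of the mean map with error ε
  -- makes f monotone along the segment; f(0) ≤ f(1) is the claim.
  let f : ℝ → ℝ := fun t => Real.log (partition P₀ (β + t • h)) - t * inner ℝ (meanMap P₀ β) h -
    t ^ 2 * (q / 2)
  have hder : ∀ t ∈ Icc (0 : ℝ) 1, HasDerivAt f
      (inner ℝ (meanMap P₀ (β + t • h)) h - inner ℝ (meanMap P₀ β) h - t * q) t := by
    intro t ht
    have h1 := (hasStrictFDerivAt_log_partition (hball (hmem t ht)).1).hasFDerivAt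
    have h2 : HasDerivAt (fun t : ℝ => β + t • h) h t := by
      simpa using ((hasDerivAt_id t).smul_const h).const_add β
    have h3 := h1.comp_hasDerivAt t h2
    have h4 := (h3.sub ((hasDerivAt_id t).mul_const (inner ℝ (meanMap P₀ β) h))).sub
      ((hasDerivAt_pow 2 t).mul_const (q / 2))
    refine h4.congr_deriv ?_
    simp
    ring
  have hmono : MonotoneOn f (Icc 0 1) := by
    refine monotoneOn_of_deriv_nonneg (convex_Icc 0 1)
      (fun t ht => (hder t ht).continuousAt.continuousWithinAt) (fun t ht => ?_) fun t ht => ?_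
    · exact (hder t (interior_subset ht)).differentiableAt.differentiableWithinAt
    · have ht' := interior_subset ht
      rw [(hder t ht').deriv]
      have h5 := (hball (hmem t ht')).2
      simp only [mem_ofPred_eq, add_sub_cancel_left, map_smul, norm_smul,
        Real.norm_of_nonneg ht'.1] at h5
      have h6 := neg_le_of_abs_le (abs_real_inner_le_norm
        (meanMap P₀ (β + t • h) - meanMap P₀ β - t • covOp P₀ β h) h)
      rw [inner_sub_left, inner_sub_left, inner_smul_left,
        real_inner_comm h (covOp P₀ β h)] at h6
      simp only [conj_trivial] at h6
      have h7 := mul_le_mul_of_nonneg_right h5 (norm_nonneg h)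
      rw [hq]
      nlinarith
  have hfin := hmono (left_mem_Icc.2 zero_le_one) (right_mem_Icc.2 zero_le_one) zero_le_one
  simp only [f, one_smul, zero_smul, add_zero, zero_mul, one_mul, hh, add_sub_cancel] at hfin
  rw [bregman]
  norm_num at hfin ⊢
  linarith

theorem exists_covOp_ge (hcc : (interior (convexCore P₀)).Nonempty)
    (hβ : β ∈ interior (canonicalSpace P₀)) :
    ∃ c > 0, ∀ h, c * ‖h‖ ^ 2 ≤ inner ℝ h (covOp P₀ β h) := by
  -- The unit sphere is empty only in dimension 0, where there is nothing to minimize.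
  rcases (Metric.sphere (0 : EuclideanSpace ℝ (Fin d)) 1).eq_empty_or_nonempty with he | hne
  · refine ⟨1, one_pos, fun h => ?_⟩
    have : h = 0 := by
      by_contra h0
      have : (‖h‖⁻¹ • h) ∈ Metric.sphere (0 : EuclideanSpace ℝ (Fin d)) 1 := by
        simp [norm_smul, h0]
      simp [he] at this
    simp [this]
  · obtain ⟨u, hu, hmin⟩ := (isCompact_sphere (0 : EuclideanSpace ℝ (Fin d)) 1).exists_isMinOn hne
      (f := fun h => inner ℝ h (covOp P₀ β h)) (Continuous.continuousOn (by fun_prop))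
    have hu0 : u ≠ 0 := by
      rintro rfl
      simp at hu
    refine ⟨_, inner_covOp_self_pos hcc hβ hu0, fun h => ?_⟩
    by_cases h0 : h = 0
    · simp [h0]
    · have hm : (‖h‖⁻¹ • h) ∈ Metric.sphere (0 : EuclideanSpace ℝ (Fin d)) 1 := by
        simp [norm_smul, h0]
      have h1 := isMinOn_iff.1 hmin _ hm
      simp only [map_smul, inner_smul_left, inner_smul_right, conj_trivial] at h1
      have hn : 0 < ‖h‖ := norm_pos_iff.2 h0
      calc inner ℝ u (covOp P₀ β u) * ‖h‖ ^ 2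
          ≤ (‖h‖⁻¹ * (‖h‖⁻¹ * inner ℝ h (covOp P₀ β h))) * ‖h‖ ^ 2 := by gcongr
        _ = _ := by field_simp

/-- Convexity of log Z: the divergence is already positive at a small distance s from β, and along a
ray it keeps growing at least at that rate. No smoothness at γ is used, so γ may lie on the boundary
of Γ. -/
theorem exists_bregman_ge_linear (hcc : (interior (convexCore P₀)).Nonempty)
    (hβ : β ∈ interior (canonicalSpace P₀)) {r : ℝ} (hr : 0 < r) :
    ∃ c > 0, ∀ γ ∈ canonicalSpace P₀, r ≤ ‖γ - β‖ → c * ‖γ - β‖ ≤ bregman P₀ β γ := by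
  obtain ⟨c, hc, hcov⟩ := exists_covOp_ge hcc hβ
  obtain ⟨r₁, hr₁, hquad⟩ := exists_bregman_ge_quadratic hβ (half_pos hc)
  set s := min r (r₁ / 2) with hs
  have hs0 : 0 < s := lt_min hr (half_pos hr₁)
  refine ⟨c / 4 * s, by positivity, fun γ hγ hrγ => ?_⟩
  set L := ‖γ - β‖ with hL
  have hL0 : 0 < L := hr.trans_le hrγ
  have hsL : s ≤ L := (min_le_left _ _).trans hrγ
  set b := β + (s / L) • (γ - β) with hb
  have hbβ : b - β = (s / L) • (γ - β) := by rw [hb, add_sub_cancel_left]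
  have hnb : ‖b - β‖ = s := by
    rw [hbβ, norm_smul, Real.norm_of_nonneg (by positivity), ← hL]
    field_simp
  have hbb : b ∈ Metric.ball β r₁ := by
    rw [mem_ball_iff_norm, hnb]
    exact (min_le_right _ _).trans_lt (half_lt_self hr₁)
  obtain ⟨hbΓ, hq⟩ := hquad b hbb
  have h1 := hcov (b - β)
  rw [hnb] at hq h1
  have hF : c / 4 * s ^ 2 ≤ bregman P₀ β b := by linarith
  have hγb : γ - b = (1 - s / L) • (γ - β) := by rw [hb, sub_smul, one_smul]; abel
  -- The two tangent inequalities at b, towards γ and towards β. The one at β bounds the slope of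
  -- log Z at b from below; the one at γ carries that slope on to γ.
  have hsupγ : 0 ≤ bregman P₀ b γ := by
    have := log_density_le (hasMean_meanMap hbΓ) hγ
    rw [bregman_eq (interior_subset hbΓ) hγ]; linarith
  have hsupβ : 0 ≤ bregman P₀ b β := by
    have := log_density_le (hasMean_meanMap hbΓ) (interior_subset hβ)
    rw [bregman_eq (interior_subset hbΓ) (interior_subset hβ)]; linarith
  rw [bregman, hγb, inner_smul_right] at hsupγ
  rw [bregman, ← neg_sub b β, hbβ, inner_neg_right, inner_smul_right] at hsupβ
  rw [bregman, hbβ, inner_smul_right] at hF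
  rw [bregman]
  set p := inner ℝ (meanMap P₀ b) (γ - β)
  set p₀ := inner ℝ (meanMap P₀ β) (γ - β)
  have hslope : c / 4 * s * L ≤ p - p₀ := by
    have h4 : s / L * (c / 4 * s * L) = c / 4 * s ^ 2 := by field_simp
    have h5 : s / L * (c / 4 * s * L) ≤ s / L * (p - p₀) := by linarith
    exact le_of_mul_le_mul_left h5 (by positivity)
  have hst : 0 ≤ 1 - s / L := by rw [sub_nonneg, div_le_one hL0]; exact hsL
  have h2 := mul_le_mul_of_nonneg_left hslope hst
  have h3 : c / 4 * s * L = (1 - s / L) * (c / 4 * s * L) + c / 4 * s ^ 2 := by field_simp; ring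
  linarith

end ExpFam

/-! ### Sequences in the support with bounded deviation from a point. -/

namespace ExpFam

variable {d : ℕ} {P₀ : Measure (EuclideanSpace ℝ (Fin d))} [IsProbabilityMeasure P₀]
  {x : EuclideanSpace ℝ (Fin d)}

/-- Otherwise a closed half-space with x on its boundary would have probability one and contain the
convex core, so x would not be interior. -/
theorem exists_mem_support_inner_neg (hx : x ∈ interior (convexCore P₀))
    {u : EuclideanSpace ℝ (Fin d)} (hu : u ≠ 0) : ∃ s ∈ P₀.support, inner ℝ u (s - x) < 0 := by
  by_contra! hcon
  let H : Set (EuclideanSpace ℝ (Fin d)) := {y | inner ℝ u x ≤ inner ℝ u y}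
  have hHm : MeasurableSet H := measurableSet_le measurable_const
    (Continuous.measurable (by fun_prop))
  have hH : H ∈ {C | Convex ℝ C ∧ MeasurableSet C ∧ P₀ C = 1} := by
    refine ⟨convex_halfSpace_ge (innerSL ℝ u).toLinearMap.isLinear _, hHm, ?_⟩
    refine (mem_ae_iff_prob_eq_one hHm).1 ?_
    filter_upwards [Measure.support_mem_ae (μ := P₀)] with s hs
    have := hcon s hs
    rw [inner_sub_right] at this
    exact sub_nonneg.1 this
  obtain ⟨t, ht1, ht2⟩ := (((tendsto_add_smul_nhdsGT x (-u)).eventually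
    (mem_interior_iff_mem_nhds.1 hx)).and self_mem_nhdsWithin).exists
  have ht2 : 0 < t := ht2
  have h1 : inner ℝ u x ≤ inner ℝ u (x + t • -u) := mem_sInter.1 ht1 H hH
  rw [inner_add_right, inner_smul_right, inner_neg_right, real_inner_self_eq_norm_sq] at h1
  have : 0 < ‖u‖ := norm_pos_iff.2 hu
  nlinarith [mul_pos ht2 (pow_pos this 2)]

/-- A support point chosen for one direction also serves nearby directions, so compactness of the
sphere makes the bounds uniform. -/
theorem exists_bound_support_inner_le (hx : x ∈ interior (convexCore P₀)) :
    ∃ R > 0, ∃ δ > 0, ∀ u : EuclideanSpace ℝ (Fin d),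
      ∃ s ∈ P₀.support, ‖s - x‖ ≤ R ∧ inner ℝ u (s - x) ≤ -(δ * ‖u‖) := by
  have key : ∃ R > 0, ∃ δ > 0, ∀ u ∈ Metric.sphere (0 : EuclideanSpace ℝ (Fin d)) 1,
      ∃ s ∈ P₀.support, ‖s - x‖ ≤ R ∧ inner ℝ u (s - x) ≤ -δ := by
    refine (isCompact_sphere (0 : EuclideanSpace ℝ (Fin d)) 1).induction_on
      (p := fun A => ∃ R > 0, ∃ δ > 0, ∀ u ∈ A,
        ∃ s ∈ P₀.support, ‖s - x‖ ≤ R ∧ inner ℝ u (s - x) ≤ -δ) ?_ ?_ ?_ ?_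
    · exact ⟨1, one_pos, 1, one_pos, by simp⟩
    · rintro A B hAB ⟨R, hR, δ, hδ, h⟩
      exact ⟨R, hR, δ, hδ, fun u hu => h u (hAB hu)⟩
    · rintro A B ⟨R, hR, δ, hδ, h⟩ ⟨R', hR', δ', hδ', h'⟩
      refine ⟨max R R', lt_max_of_lt_left hR, min δ δ', lt_min hδ hδ', ?_⟩
      rintro u (hu | hu)
      · obtain ⟨s, hs, h1, h2⟩ := h u hu
        exact ⟨s, hs, h1.trans (le_max_left _ _), h2.trans (neg_le_neg (min_le_left _ _))⟩
      · obtain ⟨s, hs, h1, h2⟩ := h' u hu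
        exact ⟨s, hs, h1.trans (le_max_right _ _), h2.trans (neg_le_neg (min_le_right _ _))⟩
    · intro u hu
      have hu0 : u ≠ 0 := by
        rintro rfl
        simp at hu
      obtain ⟨s, hs, hneg⟩ := exists_mem_support_inner_neg hx hu0
      refine ⟨{v | inner ℝ v (s - x) < inner ℝ u (s - x) / 2}, mem_nhdsWithin_of_mem_nhds ?_,
        ‖s - x‖ + 1, by positivity, -(inner ℝ u (s - x) / 2), by linarith, fun v hv => ?_⟩
      · exact (isOpen_lt (by fun_prop) continuous_const).mem_nhds
          (show inner ℝ u (s - x) < inner ℝ u (s - x) / 2 by linarith)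
      · have hv : inner ℝ v (s - x) < inner ℝ u (s - x) / 2 := hv
        exact ⟨s, hs, by linarith, by linarith⟩
  obtain ⟨R, hR, δ, hδ, h⟩ := key
  have hne : P₀.support.Nonempty := by
    rw [nonempty_iff_ne_empty]
    intro h0
    have := Measure.support_mem_ae (μ := P₀)
    rw [h0, mem_ae_iff] at this
    simp at this
  obtain ⟨s₀, hs₀⟩ := hne
  refine ⟨R + ‖s₀ - x‖, by positivity, δ, hδ, fun u => ?_⟩
  by_cases hu : u = 0
  · exact ⟨s₀, hs₀, by linarith, by simp [hu]⟩
  · have hn : 0 < ‖u‖ := norm_pos_iff.2 hu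
    obtain ⟨s, hs, h1, h2⟩ := h (‖u‖⁻¹ • u) (by simp [norm_smul, hu])
    refine ⟨s, hs, by linarith [norm_nonneg (s₀ - x)], ?_⟩
    rw [inner_smul_left, conj_trivial, inv_mul_le_iff₀ hn] at h2
    linarith

/-- Points in the interior of the convex core are approximated by averages of support points with
bounded discrepancy. -/
theorem exists_support_seq_bounded_sum (hx : x ∈ interior (convexCore P₀)) :
    ∃ y : ℕ → EuclideanSpace ℝ (Fin d), (∀ k, y k ∈ P₀.support) ∧
      ∃ K, ∀ n, ‖∑ k ∈ Finset.range n, (y k - x)‖ ≤ K := by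
  obtain ⟨R, hR, δ, hδ, h⟩ := exists_bound_support_inner_le hx
  choose g hg hgR hgδ using h
  -- Greedy choice: each new support point is taken on the side opposite to the accumulated
  -- deviation.
  let S : ℕ → EuclideanSpace ℝ (Fin d) := fun n => Nat.rec 0 (fun _ s => s + (g s - x)) n
  have hS : ∀ n, ∑ k ∈ Finset.range n, (g (S k) - x) = S n := by
    intro n
    induction n with
    | zero => rfl
    | succ n ih => rw [Finset.sum_range_succ, ih]
  -- Beyond norm `R ^ 2 / (2 * δ)` the cross term -2δ‖S‖ outweighs the squared step length R², so
  -- the norm does not grow; below it, one step adds at most R.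
  refine ⟨fun k => g (S k), fun k => hg _, R ^ 2 / (2 * δ) + R, fun n => ?_⟩
  rw [hS]
  induction n with
  | zero =>
    change ‖(0 : EuclideanSpace ℝ (Fin d))‖ ≤ _
    rw [norm_zero]
    positivity
  | succ n ih =>
    change ‖S n + (g (S n) - x)‖ ≤ _
    rcases le_total ‖S n‖ (R ^ 2 / (2 * δ)) with hle | hle
    · exact (norm_add_le _ _).trans (add_le_add hle (hgR _))
    · refine le_trans ?_ ih
      rw [div_le_iff₀ (by positivity)] at hle
      refine le_of_sq_le_sq ?_ (norm_nonneg _)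
      rw [norm_add_sq_real]
      have h1 := hgδ (S n)
      have h2 := pow_le_pow_left₀ (norm_nonneg _) (hgR (S n)) 2
      linarith

end ExpFam

/-! ### Near and far contributions to the Laplace integral. -/

namespace ExpFam

variable {d : ℕ} {P₀ : Measure (EuclideanSpace ℝ (Fin d))} [IsProbabilityMeasure P₀]
  {x β : EuclideanSpace ℝ (Fin d)}

/-- The quadratic bound moved to mean coordinates, in which the prior lives: near β the displacement
of the mean is the covariance operator applied to γ - β, up to a small error. -/
theorem exists_bregman_ge_whitened (hcc : (interior (convexCore P₀)).Nonempty)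
    (hβ : β ∈ interior (canonicalSpace P₀))
    {T : EuclideanSpace ℝ (Fin d) ≃L[ℝ] EuclideanSpace ℝ (Fin d)}
    (hT : ∀ v, ‖T (covOp P₀ β v)‖ ^ 2 = inner ℝ v (covOp P₀ β v)) {ε : ℝ} (hε : 0 < ε)
    (hε1 : ε < 1) :
    ∃ r > 0, ∀ γ ∈ Metric.ball β r,
      (1 - ε) / 2 * ‖T (meanMap P₀ γ - meanMap P₀ β)‖ ^ 2 ≤ bregman P₀ β γ := by
  obtain ⟨c, hc, hcov⟩ := exists_covOp_ge hcc hβ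
  -- Since c‖h‖² ≤ N², this error costs at most the fraction ε/4 of N².
  obtain ⟨r₁, hr₁, hquad⟩ := exists_bregman_ge_quadratic hβ (show 0 < c * (ε / 4) by positivity)
  set t := ‖(T : EuclideanSpace ℝ (Fin d) →L[ℝ] EuclideanSpace ℝ (Fin d))‖ with ht
  have ht0 : 0 ≤ t := norm_nonneg _
  -- Chosen so that `T` maps the linearization error to norm at most (ε/4)N, by √c‖h‖ ≤ N; the `+ 1`
  -- avoids division by zero.
  set κ := ε / 4 * Real.sqrt c / (t + 1) with hκ
  have hκ0 : 0 < κ := by positivity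
  have hlo := (hasStrictFDerivAt_meanMap hβ).hasFDerivAt.isLittleO.def hκ0
  obtain ⟨r₂, hr₂, hball⟩ := Metric.mem_nhds_iff.1 hlo
  refine ⟨min r₁ r₂, lt_min hr₁ hr₂, fun γ hγ => ?_⟩
  obtain ⟨-, hq⟩ := hquad γ (Metric.ball_subset_ball (min_le_left _ _) hγ)
  have hl : ‖meanMap P₀ γ - meanMap P₀ β - covOp P₀ β (γ - β)‖ ≤ κ * ‖γ - β‖ :=
    hball (Metric.ball_subset_ball (min_le_right _ _) hγ)
  set h := γ - β
  set A := covOp P₀ β h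
  set N := ‖T A‖
  have hN2 : N ^ 2 = inner ℝ h A := hT h
  have hcN : c * ‖h‖ ^ 2 ≤ N ^ 2 := by rw [hN2]; exact hcov h
  have hsN : Real.sqrt c * ‖h‖ ≤ N := by
    refine le_of_sq_le_sq ?_ (norm_nonneg _)
    rw [mul_pow, Real.sq_sqrt hc.le]
    exact hcN
  have hTle : ‖T (meanMap P₀ γ - meanMap P₀ β)‖ ≤ (1 + ε / 4) * N := by
    have h1 : T (meanMap P₀ γ - meanMap P₀ β) = T A + T (meanMap P₀ γ - meanMap P₀ β - A) := by
      rw [← map_add]; congr 1; abel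
    have h2 : ‖T (meanMap P₀ γ - meanMap P₀ β - A)‖ ≤ t * (κ * ‖h‖) :=
      ((T : EuclideanSpace ℝ (Fin d) →L[ℝ] EuclideanSpace ℝ (Fin d)).le_opNorm _).trans
        (mul_le_mul_of_nonneg_left hl ht0)
    have h3 : t * (κ * ‖h‖) ≤ ε / 4 * N := by
      calc t * (κ * ‖h‖) = t / (t + 1) * (ε / 4 * (Real.sqrt c * ‖h‖)) := by
            rw [hκ]; field_simp
        _ ≤ 1 * (ε / 4 * N) := by
            gcongr
            rw [div_le_one (by positivity)]
            linarith
        _ = _ := one_mul _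
    rw [h1]
    linarith [norm_add_le (T A) (T (meanMap P₀ γ - meanMap P₀ β - A))]
  have hsq := pow_le_pow_left₀ (norm_nonneg _) hTle 2
  have hcoef : (1 - ε) * (1 + ε / 4) ^ 2 ≤ 1 - ε / 4 := by
    nlinarith [mul_pos hε hε, mul_pos (mul_pos hε hε) hε]
  calc (1 - ε) / 2 * ‖T (meanMap P₀ γ - meanMap P₀ β)‖ ^ 2
      ≤ (1 - ε) / 2 * ((1 + ε / 4) * N) ^ 2 := by
        refine mul_le_mul_of_nonneg_left hsq (by linarith)
    _ = ((1 - ε) * (1 + ε / 4) ^ 2) * N ^ 2 / 2 := by ring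
    _ ≤ (1 - ε / 4) * N ^ 2 / 2 := by gcongr
    _ ≤ (inner ℝ h A - c * (ε / 4) * ‖h‖ ^ 2) / 2 := by
        rw [← hN2]
        nlinarith [mul_le_mul_of_nonneg_left hcN hε.le]
    _ ≤ _ := hq

theorem volume_ellipsoid_pos (T : EuclideanSpace ℝ (Fin d) ≃L[ℝ] EuclideanSpace ℝ (Fin d))
    (x : EuclideanSpace ℝ (Fin d)) {r : ℝ} (hr : 0 < r) : 0 < volume (ellipsoid T x r) :=
  (Metric.measure_closedBall_pos volume x (by positivity)).trans_le
    (measure_mono (closedBall_subset_ellipsoid T x r))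

theorem volume_ellipsoid_lt_top (T : EuclideanSpace ℝ (Fin d) ≃L[ℝ] EuclideanSpace ℝ (Fin d))
    (x : EuclideanSpace ℝ (Fin d)) (r : ℝ) : volume (ellipsoid T x r) < ∞ :=
  (measure_mono (ellipsoid_subset_closedBall T x r)).trans_lt measure_closedBall_lt_top

theorem ellipsoid_mem_nhds (T : EuclideanSpace ℝ (Fin d) ≃L[ℝ] EuclideanSpace ℝ (Fin d))
    (x : EuclideanSpace ℝ (Fin d)) {r : ℝ} (hr : 0 < r) : ellipsoid T x r ∈ 𝓝 x :=
  Filter.mem_of_superset (Metric.closedBall_mem_nhds x (by positivity))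
    (closedBall_subset_ellipsoid T x r)

theorem eventually_ellipsoid_subset
    (T : EuclideanSpace ℝ (Fin d) ≃L[ℝ] EuclideanSpace ℝ (Fin d))
    {x : EuclideanSpace ℝ (Fin d)} {U : Set (EuclideanSpace ℝ (Fin d))} (hU : U ∈ 𝓝 x) :
    ∀ᶠ r in 𝓝[>] (0 : ℝ), ellipsoid T x r ⊆ U := by
  obtain ⟨ρ, hρ, hball⟩ := Metric.mem_nhds_iff.1 hU
  set a := ‖(T.symm : EuclideanSpace ℝ (Fin d) →L[ℝ] EuclideanSpace ℝ (Fin d))‖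
  have : Tendsto (fun r : ℝ => a * r) (𝓝[>] 0) (𝓝 0) := by
    have : Tendsto (fun r : ℝ => a * r) (𝓝 0) (𝓝 (a * 0)) := Continuous.tendsto (by fun_prop) 0
    rw [mul_zero] at this
    exact this.mono_left nhdsWithin_le_nhds
  filter_upwards [this.eventually (gt_mem_nhds hρ)] with r hr
  exact (ellipsoid_subset_closedBall T x r).trans
    ((Metric.closedBall_subset_ball hr).trans hball)

/-- Contribution of a small ellipsoid to a Laplace integral, at a point where the measure is
dominated by `a` times the volume. -/
theorem exists_ellipsoid_laplace_le (hΓ : (interior (canonicalSpace P₀)).Nonempty)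
    (hcc : (interior (convexCore P₀)).Nonempty) (hx : x ∈ interior (meanRange P₀))
    {η : Measure (EuclideanSpace ℝ (Fin d))} {w : EuclideanSpace ℝ (Fin d) → ℝ≥0∞}
    (hw : AEMeasurable w (η.restrict (interior (meanRange P₀))))
    {T : EuclideanSpace ℝ (Fin d) ≃L[ℝ] EuclideanSpace ℝ (Fin d)}
    (hTdet : |(LinearMap.det
      (T : EuclideanSpace ℝ (Fin d) →ₗ[ℝ] EuclideanSpace ℝ (Fin d)))⁻¹| =
        Real.sqrt (covMatrix P₀ x).det)
    (hT : ∀ v, ‖T (covOp P₀ (betaHat P₀ x) v)‖ ^ 2 = inner ℝ v (covOp P₀ (betaHat P₀ x) v))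
    {g a : ℝ≥0∞} (hlim : Tendsto (fun r =>
      ((η.restrict (interior (meanRange P₀))).withDensity w) (ellipsoid T x r) /
        volume (ellipsoid T x r)) (𝓝[>] 0) (𝓝 g))
    (hga : g < a) (ha : a ≠ ∞) (K : ℝ) {ε : ℝ} (hε : 0 < ε) (hε1 : ε < 1) :
    ∃ r > 0, ∀ N : ℝ, 0 < N → ∀ s : EuclideanSpace ℝ (Fin d), ‖s‖ ≤ K →
      ∫⁻ z in ellipsoid T x r, ENNReal.ofReal (Real.exp
          (-(N * bregman P₀ (betaHat P₀ x) (betaHat P₀ z)) +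
            inner ℝ (betaHat P₀ z - betaHat P₀ x) s)) * w z ∂η ≤
        a * ENNReal.ofReal (Real.exp ε * (Real.sqrt (covMatrix P₀ x).det *
          (2 * Real.pi / (N * (1 - ε))) ^ ((d : ℝ) / 2))) := by
  set b := betaHat P₀ x with hb
  set μ := (η.restrict (interior (meanRange P₀))).withDensity w with hμ
  have hbΓ := betaHat_mem_interior hΓ hcc hx
  obtain ⟨r₁, hr₁, hbreg⟩ := exists_bregman_ge_whitened hcc hbΓ hT hε hε1
  have hcont := continuousAt_betaHat hΓ hcc hx
  -- The second bound keeps the linear term ⟨β̂(z) - β̂(x), s⟩ below ε when ‖s‖ ≤ K.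
  set ρ := min r₁ (ε / (|K| + 1)) with hρ
  have hρ0 : 0 < ρ := lt_min hr₁ (by positivity)
  have hU : interior (meanRange P₀) ∩ betaHat P₀ ⁻¹' (Metric.ball b ρ) ∈ 𝓝 x :=
    Filter.inter_mem (isOpen_interior.mem_nhds hx) (hcont (Metric.ball_mem_nhds _ hρ0))
  have hev := (hlim.eventually (gt_mem_nhds hga)).and (eventually_ellipsoid_subset T hU)
  -- The mass bound must hold for every radius up to r₀, as the layer-cake argument uses them all.
  obtain ⟨r₀, hr₀, hr₀'⟩ := mem_nhdsGT_iff_exists_Ioc_subset.1 hev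
  have hr₀ : 0 < r₀ := hr₀
  have hsub : ellipsoid T x r₀ ⊆ interior (meanRange P₀) ∩ betaHat P₀ ⁻¹' (Metric.ball b ρ) :=
    (hr₀' (right_mem_Ioc.2 hr₀)).2
  have hle : ∀ r, 0 < r → r ≤ r₀ → μ (ellipsoid T x r) ≤ a * volume (ellipsoid T x r) := by
    intro r hr hrr
    have h1 : μ (ellipsoid T x r) / volume (ellipsoid T x r) < a := (hr₀' ⟨hr, hrr⟩).1
    exact (ENNReal.div_le_iff (volume_ellipsoid_pos T x hr).ne'
      (volume_ellipsoid_lt_top T x r).ne).1 h1.le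
  refine ⟨r₀, hr₀, fun N hN s hs => ?_⟩
  have hB : 0 < N * ((1 - ε) / 2) := mul_pos hN (by linarith)
  set G : EuclideanSpace ℝ (Fin d) → ℝ≥0∞ := fun z =>
    ENNReal.ofReal (Real.exp (-(N * ((1 - ε) / 2)) * ‖T (z - x)‖ ^ 2)) with hG
  have hGm : Measurable G := Measurable.ennreal_ofReal (Continuous.measurable (by fun_prop))
  have hms := measurableSet_ellipsoid T x r₀
  calc ∫⁻ z in ellipsoid T x r₀, ENNReal.ofReal (Real.exp
          (-(N * bregman P₀ b (betaHat P₀ z)) + inner ℝ (betaHat P₀ z - b) s)) * w z ∂η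
      ≤ ∫⁻ z in ellipsoid T x r₀, ENNReal.ofReal (Real.exp ε) * (w * G) z ∂η := by
        refine setLIntegral_mono' hms fun z hz => ?_
        obtain ⟨hzM, hzb⟩ := hsub hz
        have hzb : betaHat P₀ z ∈ Metric.ball b ρ := hzb
        have h1 := hbreg _ (Metric.ball_subset_ball (min_le_left _ _) hzb)
        rw [meanMap_betaHat hΓ hcc hzM, meanMap_betaHat hΓ hcc hx] at h1
        have h2 : inner ℝ (betaHat P₀ z - b) s ≤ ε := by
          have h3 : ‖betaHat P₀ z - b‖ ≤ ε / (|K| + 1) :=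
            (mem_ball_iff_norm.1 hzb).le.trans (min_le_right _ _)
          calc inner ℝ (betaHat P₀ z - b) s ≤ ‖betaHat P₀ z - b‖ * ‖s‖ := real_inner_le_norm _ _
            _ ≤ ε / (|K| + 1) * (|K| + 1) := by
                gcongr
                linarith [le_abs_self K]
            _ = ε := by field_simp
        rw [Pi.mul_apply, mul_comm (w z), ← mul_assoc]
        refine mul_le_mul' ?_ le_rfl
        rw [hG, ← ENNReal.ofReal_mul (Real.exp_pos _).le, ← Real.exp_add]
        refine ENNReal.ofReal_le_ofReal (Real.exp_le_exp.2 ?_)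
        have h4 := mul_le_mul_of_nonneg_left h1 hN.le
        linarith
    _ = ENNReal.ofReal (Real.exp ε) * ∫⁻ z in ellipsoid T x r₀, (w * G) z ∂η :=
        lintegral_const_mul' _ _ ENNReal.ofReal_ne_top
    _ = ENNReal.ofReal (Real.exp ε) * ∫⁻ z in ellipsoid T x r₀, G z ∂μ := by
        rw [hμ, setLIntegral_withDensity_eq_lintegral_mul₀ hw hGm.aemeasurable hms,
          Measure.restrict_restrict hms,
          inter_eq_left.2 fun z hz => (hsub hz).1]
    _ ≤ ENNReal.ofReal (Real.exp ε) * (a * ∫⁻ z in ellipsoid T x r₀, G z) := by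
        gcongr
        exact setLIntegral_gaussian_le_of_ellipsoid μ T x hr₀ hB ha hle
    _ ≤ ENNReal.ofReal (Real.exp ε) * (a * ∫⁻ z, G z) := by
        gcongr
        exact Measure.restrict_le_self
    _ = _ := by
        rw [hG, lintegral_gaussian_ellipsoid T x hB, hTdet, mul_left_comm,
          ← ENNReal.ofReal_mul (Real.exp_pos _).le, finrank_euclideanSpace_fin]
        have hpi : Real.pi / (N * ((1 - ε) / 2)) = 2 * Real.pi / (N * (1 - ε)) := by
          rw [mul_div_assoc', div_div_eq_mul_div, mul_comm Real.pi]
        rw [hpi]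

/-- Contribution of the complement of a neighbourhood to a Laplace integral. -/
theorem exists_compl_laplace_le (hΓ : (interior (canonicalSpace P₀)).Nonempty)
    (hcc : (interior (convexCore P₀)).Nonempty) (hx : x ∈ interior (meanRange P₀))
    {η : Measure (EuclideanSpace ℝ (Fin d))} (hη : η (meanRange P₀)ᶜ = 0)
    (w : EuclideanSpace ℝ (Fin d) → ℝ≥0∞) {U : Set (EuclideanSpace ℝ (Fin d))} (hU : U ∈ 𝓝 x)
    (hUm : MeasurableSet U) (K : ℝ) :
    ∃ c > 0, ∃ C : ℝ, ∀ᶠ N : ℝ in atTop, ∀ s : EuclideanSpace ℝ (Fin d), ‖s‖ ≤ K →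
      ∫⁻ z in Uᶜ, ENNReal.ofReal (Real.exp
          (-(N * bregman P₀ (betaHat P₀ x) (betaHat P₀ z)) +
            inner ℝ (betaHat P₀ z - betaHat P₀ x) s)) * w z ∂η ≤
        ENNReal.ofReal (Real.exp (-(c * N) + C)) * ∫⁻ z, w z ∂η := by
  set b := betaHat P₀ x with hb
  have hbΓ := betaHat_mem_interior hΓ hcc hx
  have hUb : interior (canonicalSpace P₀) ∩ meanMap P₀ ⁻¹' U ∈ 𝓝 b := by
    refine Filter.inter_mem (isOpen_interior.mem_nhds hbΓ) ?_
    have h := (hasStrictFDerivAt_meanMap hbΓ).continuousAt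
    rw [ContinuousAt, meanMap_betaHat hΓ hcc hx] at h
    exact h hU
  obtain ⟨r, hr, hball⟩ := Metric.mem_nhds_iff.1 hUb
  obtain ⟨c, hc, hlin⟩ := exists_bregman_ge_linear hcc hbΓ hr
  -- For Nc ≥ K the exponent is at most -(Nc - K)‖β̂(z) - b‖, hence at most -(Nc - K)r.
  refine ⟨c * r, by positivity, K * r, ?_⟩
  filter_upwards [eventually_ge_atTop (K / c), eventually_ge_atTop 0] with N hN hN0 s hs
  have hN : K ≤ N * c := (div_le_iff₀ hc).1 hN
  rw [← lintegral_const_mul' _ _ ENNReal.ofReal_ne_top]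
  refine (lintegral_mono_ae ?_).trans (setLIntegral_le_lintegral Uᶜ _)
  have hηM : ∀ᵐ z ∂η, z ∈ meanRange P₀ := hη
  filter_upwards [ae_restrict_of_ae hηM, ae_restrict_mem hUm.compl] with z hzM hzU
  refine mul_le_mul' (ENNReal.ofReal_le_ofReal (Real.exp_le_exp.2 ?_)) le_rfl
  have hm := hasMean_betaHat hzM
  -- Here z may be a boundary point of M, where β̂ need not be continuous; continuity of the mean
  -- map at b is used instead.
  have hrz : r ≤ ‖betaHat P₀ z - b‖ := by
    by_contra! hlt
    obtain ⟨h1, h2⟩ := hball (mem_ball_iff_norm.2 hlt)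
    have h3 : meanMap P₀ (betaHat P₀ z) = z := by
      rw [← (hasMean_meanMap h1).2.2, hm.2.2]
    rw [mem_preimage, h3] at h2
    exact hzU h2
  have h4 := hlin _ hm.1 hrz
  have h5 : inner ℝ (betaHat P₀ z - b) s ≤ ‖betaHat P₀ z - b‖ * K :=
    (real_inner_le_norm _ _).trans (mul_le_mul_of_nonneg_left hs (norm_nonneg _))
  have h6 := mul_le_mul_of_nonneg_left h4 hN0
  have h7 := mul_le_mul_of_nonneg_left hrz (sub_nonneg.2 hN)
  linarith

end ExpFam

/-! ### The Laplace bound, the choice of the point, and likelihood identities. -/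

namespace ExpFam

variable {d : ℕ} {P₀ : Measure (EuclideanSpace ℝ (Fin d))} [IsProbabilityMeasure P₀]
  {x : EuclideanSpace ℝ (Fin d)}

/-- Upper bound for Laplace integrals at a differentiability point of the weighted prior. -/
theorem eventually_laplace_le (hΓ : (interior (canonicalSpace P₀)).Nonempty)
    (hcc : (interior (convexCore P₀)).Nonempty) (hx : x ∈ interior (meanRange P₀))
    {η : Measure (EuclideanSpace ℝ (Fin d))} (hη : η (meanRange P₀)ᶜ = 0)
    {w : EuclideanSpace ℝ (Fin d) → ℝ≥0∞}
    (hw : AEMeasurable w (η.restrict (interior (meanRange P₀)))) (hI : ∫⁻ z, w z ∂η ≠ ∞)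
    {g a : ℝ≥0∞} (hlim : ∀ T : EuclideanSpace ℝ (Fin d) ≃L[ℝ] EuclideanSpace ℝ (Fin d),
      Tendsto (fun r => ((η.restrict (interior (meanRange P₀))).withDensity w) (ellipsoid T x r) /
        volume (ellipsoid T x r)) (𝓝[>] 0) (𝓝 g))
    (hga : g * ENNReal.ofReal (Real.sqrt (covMatrix P₀ x).det) < a) (m : ℕ) (K : ℝ) :
    ∀ᶠ n : ℕ in atTop, ∀ s : EuclideanSpace ℝ (Fin d), ‖s‖ ≤ K →
      ENNReal.ofReal (((n : ℝ) / (2 * Real.pi)) ^ ((d : ℝ) / 2)) *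
        ∫⁻ z, ENNReal.ofReal (Real.exp
          (-(((n : ℝ) - m) * bregman P₀ (betaHat P₀ x) (betaHat P₀ z)) +
            inner ℝ (betaHat P₀ z - betaHat P₀ x) s)) * w z ∂η ≤ a := by
  have hbΓ := betaHat_mem_interior hΓ hcc hx
  obtain ⟨T, hTdet, hT⟩ := exists_whitening hcc hbΓ
  set v := Real.sqrt (covMatrix P₀ x).det with hv
  have hv0 : 0 < v := Real.sqrt_pos.2 (posDef_covMatrix hcc hbΓ).det_pos
  have hV0 : ENNReal.ofReal v ≠ 0 := (ENNReal.ofReal_pos.2 hv0).ne'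
  have hVt : ENNReal.ofReal v ≠ ∞ := ENNReal.ofReal_ne_top
  -- The room between g√det V and a is split up: a₁ > g bounds the mass ratios of ellipsoids, a₂ >
  -- a₁√det V bounds the near part, and a - a₂ is left for the far part.
  obtain ⟨a₁, hga₁, ha₁⟩ := exists_between
    ((ENNReal.lt_div_iff_mul_lt (Or.inl hV0) (Or.inl hVt)).2 hga)
  have ha₁t : a₁ ≠ ∞ := ha₁.ne_top
  replace ha₁ := (ENNReal.lt_div_iff_mul_lt (Or.inl hV0) (Or.inl hVt)).1 ha₁
  obtain ⟨a₂, ha₁₂, ha₂⟩ := exists_between ha₁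
  have hca : a₁ * ENNReal.ofReal v ≠ ∞ := ENNReal.mul_ne_top ha₁t hVt
  -- the loss in the quadratic approximation
  have hεlim : Tendsto (fun ε : ℝ => a₁ * ENNReal.ofReal v *
      ENNReal.ofReal (Real.exp ε * (1 / (1 - ε)) ^ ((d : ℝ) / 2))) (𝓝[>] 0)
      (𝓝 (a₁ * ENNReal.ofReal v)) := by
    have h1 : ContinuousAt (fun ε : ℝ => Real.exp ε * (1 / (1 - ε)) ^ ((d : ℝ) / 2)) 0 := by
      refine Real.continuous_exp.continuousAt.mul (ContinuousAt.rpow_const ?_ (Or.inl (by norm_num)))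
      exact continuousAt_const.div (by fun_prop) (by norm_num)
    have h2 := ENNReal.tendsto_ofReal h1.tendsto
    simp only [Real.exp_zero, sub_zero, div_one, Real.one_rpow, mul_one, ENNReal.ofReal_one] at h2
    have h3 := ENNReal.Tendsto.const_mul (a := a₁ * ENNReal.ofReal v) h2 (Or.inl one_ne_zero)
    rw [mul_one] at h3
    exact h3.mono_left nhdsWithin_le_nhds
  obtain ⟨ε, hε2, hε0, hε1⟩ := ((hεlim.eventually (gt_mem_nhds ha₁₂)).and
    (Ioo_mem_nhdsGT (zero_lt_one (α := ℝ)))).exists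
  obtain ⟨r, hr, hnear⟩ := exists_ellipsoid_laplace_le hΓ hcc hx hw hTdet hT (hlim T) hga₁ ha₁t K
    hε0 hε1
  obtain ⟨c, hc, C, hfar⟩ := exists_compl_laplace_le hΓ hcc hx hη w (ellipsoid_mem_nhds T x hr)
    (measurableSet_ellipsoid T x r) K
  have htop : Tendsto (fun n : ℕ => (n : ℝ) - m) atTop atTop :=
    tendsto_atTop_add_const_right _ _ tendsto_natCast_atTop_atTop
  -- the near part
  have hnearlim : Tendsto (fun n : ℕ => a₁ * ENNReal.ofReal v * ENNReal.ofReal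
      (Real.exp ε * ((n : ℝ) / ((n - m) * (1 - ε))) ^ ((d : ℝ) / 2))) atTop
      (𝓝 (a₁ * ENNReal.ofReal v *
      ENNReal.ofReal (Real.exp ε * (1 / (1 - ε)) ^ ((d : ℝ) / 2)))) := by
    have hpos : 0 < 1 - ε := by linarith
    have h1 : Tendsto (fun n : ℕ => (n : ℝ) / ((n - m) * (1 - ε))) atTop (𝓝 (1 / (1 - ε))) := by
      have h2 : Tendsto (fun n : ℕ => (1 + (m : ℝ) / ((n : ℝ) - m)) * (1 / (1 - ε))) atTop
          (𝓝 ((1 + 0) * (1 / (1 - ε)))) :=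
        (tendsto_const_nhds.add (tendsto_const_nhds.div_atTop htop)).mul_const _
      rw [add_zero, one_mul] at h2
      refine h2.congr' ?_
      filter_upwards [htop.eventually_gt_atTop 0] with n hn
      field_simp
      ring
    refine ENNReal.Tendsto.const_mul (ENNReal.tendsto_ofReal ((h1.rpow_const
      (Or.inl (by positivity))).const_mul _)) (Or.inr hca)
  -- the far part
  have hfarlim : Tendsto (fun n : ℕ => ENNReal.ofReal (((n : ℝ) / (2 * Real.pi)) ^ ((d : ℝ) / 2) *
      Real.exp (-(c * ((n : ℝ) - m)) + C)) * ∫⁻ z, w z ∂η) atTop (𝓝 0) := by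
    have h1 := (tendsto_rpow_mul_exp_neg_mul_atTop_nhds_zero ((d : ℝ) / 2) c hc).comp
      tendsto_natCast_atTop_atTop
    have h2 := h1.mul_const ((1 / (2 * Real.pi)) ^ ((d : ℝ) / 2) * Real.exp (c * m + C))
    rw [zero_mul] at h2
    have h3 := ENNReal.Tendsto.mul_const (b := ∫⁻ z, w z ∂η) (ENNReal.tendsto_ofReal h2)
      (Or.inr hI)
    rw [ENNReal.ofReal_zero, zero_mul] at h3
    refine h3.congr fun n => ?_
    congr 2
    rw [Function.comp_apply, div_eq_mul_one_div (n : ℝ) (2 * Real.pi), Real.mul_rpow (by positivity) (by positivity),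
      show -(c * ((n : ℝ) - m)) + C = -c * n + (c * m + C) by ring,
      Real.exp_add (-c * n)]
    ring
  have hsub0 : 0 < a - a₂ := tsub_pos_of_lt ha₂
  filter_upwards [hnearlim.eventually (gt_mem_nhds hε2), hfarlim.eventually (gt_mem_nhds hsub0),
    htop.eventually hfar, htop.eventually_gt_atTop 0] with n h1 h2 h3 h4 s hs
  have hn0 : 0 ≤ (n : ℝ) / (2 * Real.pi) := by positivity
  rw [← lintegral_add_compl _ (measurableSet_ellipsoid T x r), mul_add]
  refine (add_le_add (c := ENNReal.ofReal (((n : ℝ) / (2 * Real.pi)) ^ ((d : ℝ) / 2)) * _)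
    (mul_le_mul' le_rfl (hnear _ h4 s hs)) (mul_le_mul' le_rfl (h3 s hs))).trans ?_
  rw [← add_tsub_cancel_of_le ha₂.le]
  refine add_le_add (le_of_eq_of_le ?_ h1.le) (le_of_eq_of_le ?_ h2.le)
  · rw [mul_left_comm, mul_assoc, ← ENNReal.ofReal_mul (by positivity),
      ← ENNReal.ofReal_mul (by positivity)]
    congr 2
    have h1ε : 0 < 1 - ε := by linarith
    have h5 : (n : ℝ) / ((n - m) * (1 - ε)) =
        (n : ℝ) / (2 * Real.pi) * (2 * Real.pi / (((n : ℝ) - m) * (1 - ε))) := by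
      field_simp
    rw [h5, Real.mul_rpow hn0 (by positivity)]
    ring
  · rw [← mul_assoc, ← ENNReal.ofReal_mul (by positivity)]

/-- A point at which the prior with weight `w` has a density that, relative to `w / √det V`, is at
most its average. -/
theorem exists_rnDeriv_mul_le (hΓ : (interior (canonicalSpace P₀)).Nonempty)
    (hcc : (interior (convexCore P₀)).Nonempty)
    (η : Measure (EuclideanSpace ℝ (Fin d))) (w : EuclideanSpace ℝ (Fin d) → ℝ≥0∞)
    (hI : ∫⁻ z, w z ∂η ≠ ∞)
    (hJ : ∫⁻ y in interior (meanRange P₀),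
      w y / ENNReal.ofReal (Real.sqrt (covMatrix P₀ y).det) ≠ ∞) :
    ∃ x ∈ interior (meanRange P₀), ∃ g : ℝ≥0∞,
      (∀ T : EuclideanSpace ℝ (Fin d) ≃L[ℝ] EuclideanSpace ℝ (Fin d),
        Tendsto (fun r => ((η.restrict (interior (meanRange P₀))).withDensity w)
          (ellipsoid T x r) / volume (ellipsoid T x r)) (𝓝[>] 0) (𝓝 g)) ∧
      g * ∫⁻ y in interior (meanRange P₀),
        w y / ENNReal.ofReal (Real.sqrt (covMatrix P₀ y).det) ≤
      w x / ENNReal.ofReal (Real.sqrt (covMatrix P₀ x).det) * ∫⁻ z, w z ∂η := by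
  set J := ∫⁻ y in interior (meanRange P₀),
    w y / ENNReal.ofReal (Real.sqrt (covMatrix P₀ y).det)
  set I := ∫⁻ z, w z ∂η
  set μ := (η.restrict (interior (meanRange P₀))).withDensity w
  have hμ : μ univ ≤ I := by
    rw [withDensity_apply _ MeasurableSet.univ, Measure.restrict_univ]
    exact setLIntegral_le_lintegral _ _
  have : IsFiniteMeasure μ := ⟨hμ.trans_lt hI.lt_top⟩
  -- Were the inequality to fail at every differentiation point, integrating over int M, which has
  -- positive volume, would give I·J < (∫ g)·J ≤ I·J.
  by_contra! hcon
  have hvol : volume (interior (meanRange P₀)) ≠ 0 := by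
    obtain ⟨β, hβ⟩ := hΓ
    exact (isOpen_interior.measure_pos volume ⟨_, meanMap_mem_interior hcc hβ⟩).ne'
  have hlt := setLIntegral_strict_mono (μ := (volume : Measure (EuclideanSpace ℝ (Fin d))))
    (s := interior (meanRange P₀)) isOpen_interior.measurableSet hvol
    (f := fun x => w x / ENNReal.ofReal (Real.sqrt (covMatrix P₀ x).det) * I)
    (g := fun x => μ.rnDeriv volume x * J) ((Measure.measurable_rnDeriv _ _).mul_const _)
    (by rw [lintegral_mul_const' _ _ hI]; exact ENNReal.mul_ne_top hJ hI)
    (by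
      filter_upwards [ae_tendsto_rnDeriv_ellipsoid μ] with x hx hxM
      exact hcon x hxM _ hx)
  rw [lintegral_mul_const' _ _ hI, lintegral_mul_const' _ _ hJ, mul_comm] at hlt
  refine absurd hlt (not_lt.2 (mul_le_mul' ?_ le_rfl))
  exact (Measure.setLIntegral_rnDeriv_le _).trans ((measure_mono (subset_univ _)).trans hμ)

/-- An infinite maximal log-likelihood with m > 0 would make all weights, hence the prior integral,
vanish. So it is a real number L, and L ≥ 0 because β = 0 has log-likelihood 0. -/
theorem exists_posteriorWeight_eq {η : Measure (EuclideanSpace ℝ (Fin d))} {m : ℕ}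
    {xm : Fin m → EuclideanSpace ℝ (Fin d)} (hdef : priorIntegral P₀ η xm ≠ 0) :
    ∃ L : ℝ, 0 ≤ L ∧ ∀ z, posteriorWeight P₀ xm z = ENNReal.ofReal
      (Real.exp (m * (Real.log (density P₀ (betaHat P₀ z) (sampleMean xm)) - L))) := by
  rcases Nat.eq_zero_or_pos m with rfl | hm
  -- For m = 0 the weight is 1 even where the divergence is infinite, since 0 · ⊤ = 0 in `EReal`.
  · exact ⟨0, le_rfl, fun z => by simp [posteriorWeight]⟩
  · have hm0 : (0 : ℝ) < m := by exact_mod_cast hm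
    have hcast : ((m : ℕ) : EReal) = ((m : ℝ) : EReal) := by simp
    have h0 : (0 : EReal) ≤ maxLogLikelihood P₀ (sampleMean xm) := by
      refine le_trans ?_ (le_iSup₂ (f := fun β (_ : β ∈ canonicalSpace P₀) =>
        ((Real.log (density P₀ β (sampleMean xm)) : ℝ) : EReal)) 0 zero_mem_canonicalSpace)
      simp [density, partition]
    have htop : maxLogLikelihood P₀ (sampleMean xm) ≠ ⊤ := by
      intro ht
      refine hdef ?_
      have : ∀ z, posteriorWeight P₀ xm z = 0 := by
        intro z
        rw [posteriorWeight, divergence, ht, EReal.top_sub_coe, hcast,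
          EReal.coe_mul_top_of_pos hm0, EReal.neg_top, EReal.exp_bot]
      simp [priorIntegral, this]
    obtain ⟨L, hL⟩ : ∃ L : ℝ, (L : EReal) = maxLogLikelihood P₀ (sampleMean xm) :=
      ⟨_, EReal.coe_toReal htop (ne_bot_of_le_ne_bot EReal.zero_ne_bot h0)⟩
    refine ⟨L, by rw [← hL] at h0; exact_mod_cast h0, fun z => ?_⟩
    rw [posteriorWeight, divergence, ← hL, hcast, ← EReal.coe_sub, ← EReal.coe_mul,
      ← EReal.coe_neg, EReal.exp_coe]
    congr 2
    ring

theorem prod_density {γ : EuclideanSpace ℝ (Fin d)} (hγ : γ ∈ canonicalSpace P₀)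
    (s : Finset ℕ) (ω : ℕ → EuclideanSpace ℝ (Fin d)) :
    ∏ i ∈ s, density P₀ γ (ω i) =
      Real.exp (inner ℝ γ (∑ i ∈ s, ω i) - s.card * Real.log (partition P₀ γ)) := by
  have h : ∀ y, density P₀ γ y = Real.exp (inner ℝ γ y - Real.log (partition P₀ γ)) := fun y => by
    rw [Real.exp_sub, Real.exp_log (partition_pos hγ), density]
  simp_rw [h]
  rw [← Real.exp_sum, Finset.sum_sub_distrib, inner_sum]
  simp

theorem sampleMean_eq (n : ℕ) (ω : ℕ → EuclideanSpace ℝ (Fin d)) :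
    sampleMean (fun i : Fin n => ω i) = (n : ℝ)⁻¹ • ∑ i ∈ Finset.range n, ω i := by
  rw [sampleMean, Fin.sum_univ_eq_sum_range]

theorem natCast_mul_log_density {γ : EuclideanSpace ℝ (Fin d)} (hγ : γ ∈ canonicalSpace P₀)
    (n : ℕ) (ω : ℕ → EuclideanSpace ℝ (Fin d)) :
    n * Real.log (density P₀ γ (sampleMean fun i : Fin n => ω i)) =
      inner ℝ γ (∑ i ∈ Finset.range n, ω i) - n * Real.log (partition P₀ γ) := by
  rw [log_density hγ, sampleMean_eq, inner_smul_right]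
  rcases Nat.eq_zero_or_pos n with rfl | hn
  · simp
  · have : (n : ℝ) ≠ 0 := by positivity
    field_simp

theorem tendsto_sampleMean {ω : ℕ → EuclideanSpace ℝ (Fin d)} {m : ℕ} {K : ℝ}
    (hK : ∀ n, ‖∑ i ∈ Finset.Ico m n, (ω i - x)‖ ≤ K) :
    Tendsto (fun n : ℕ => sampleMean fun i : Fin n => ω i) atTop (𝓝 x) := by
  rw [tendsto_iff_norm_sub_tendsto_zero]
  have hlim : Tendsto (fun n : ℕ => (‖∑ i ∈ Finset.range m, (ω i - x)‖ + K) / (n : ℝ)) atTop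
      (𝓝 0) := tendsto_const_nhds.div_atTop tendsto_natCast_atTop_atTop
  refine squeeze_zero' (Eventually.of_forall fun n => norm_nonneg _) ?_ hlim
  filter_upwards [eventually_ge_atTop m, eventually_gt_atTop 0] with n hn hn0
  have hn0 : (0 : ℝ) < n := by exact_mod_cast hn0
  have h1 : sampleMean (fun i : Fin n => ω i) - x =
      (n : ℝ)⁻¹ • (∑ i ∈ Finset.range m, (ω i - x) + ∑ i ∈ Finset.Ico m n, (ω i - x)) := by
    rw [Finset.sum_range_add_sum_Ico _ hn, sampleMean_eq, Finset.sum_sub_distrib, smul_sub]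
    congr 1
    rw [Finset.sum_const, Finset.card_range, ← Nat.cast_smul_eq_nsmul ℝ, smul_smul,
      inv_mul_cancel₀ hn0.ne', one_smul]
  rw [h1, norm_smul, Real.norm_of_nonneg (by positivity), ← div_eq_inv_mul]
  gcongr
  exact (norm_add_le _ _).trans (add_le_add le_rfl (hK n))

end ExpFam

/-! ### The lower bound for the regret. -/

namespace ExpFam

variable {d : ℕ} {P₀ : Measure (EuclideanSpace ℝ (Fin d))} [IsProbabilityMeasure P₀]
  {x : EuclideanSpace ℝ (Fin d)}

/-- Restricted to int M because there β̂, and with it the weight, is continuous; elsewhere no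
regularity of β̂ is established. -/
theorem aemeasurable_posteriorWeight (hΓ : (interior (canonicalSpace P₀)).Nonempty)
    (hcc : (interior (convexCore P₀)).Nonempty) {η : Measure (EuclideanSpace ℝ (Fin d))} {m : ℕ}
    {xm : Fin m → EuclideanSpace ℝ (Fin d)} (hdef : priorIntegral P₀ η xm ≠ 0) :
    AEMeasurable (posteriorWeight P₀ xm) (η.restrict (interior (meanRange P₀))) := by
  obtain ⟨L, -, hL⟩ := exists_posteriorWeight_eq hdef
  refine ContinuousOn.aemeasurable (fun z hz => ContinuousAt.continuousWithinAt ?_)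
    isOpen_interior.measurableSet
  have hfun : posteriorWeight P₀ xm = fun z => ENNReal.ofReal (Real.exp
      (m * (inner ℝ (betaHat P₀ z) (sampleMean xm) -
        Real.log (partition P₀ (betaHat P₀ z)) - L))) := by
    funext z
    rw [hL, log_density (betaHat_mem_canonicalSpace z)]
  have hb := continuousAt_betaHat hΓ hcc hz
  have hlog : ContinuousAt (fun z => Real.log (partition P₀ (betaHat P₀ z))) z :=
    ContinuousAt.comp (g := fun b => Real.log (partition P₀ b)) (f := betaHat P₀)
      (hasStrictFDerivAt_log_partition (betaHat_mem_interior hΓ hcc hz)).continuousAt hb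
  rw [hfun]
  refine ENNReal.continuous_ofReal.continuousAt.comp (Real.continuous_exp.continuousAt.comp ?_)
  exact continuousAt_const.mul (((hb.inner continuousAt_const).sub hlog).sub continuousAt_const)

/-- The predictive density, written as a Laplace integral around `x`. -/
theorem predictiveDensity_eq (hΓ : (interior (canonicalSpace P₀)).Nonempty)
    (hcc : (interior (convexCore P₀)).Nonempty) (hx : x ∈ interior (meanRange P₀))
    (η : Measure (EuclideanSpace ℝ (Fin d))) {m n : ℕ} (hmn : m ≤ n)
    (ω : ℕ → EuclideanSpace ℝ (Fin d)) :
    predictiveDensity P₀ η m n ω =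
      ENNReal.ofReal (∏ i ∈ Finset.Ico m n, density P₀ (betaHat P₀ x) (ω i)) *
        (∫⁻ z, ENNReal.ofReal (Real.exp
          (-(((n : ℝ) - m) * bregman P₀ (betaHat P₀ x) (betaHat P₀ z)) +
            inner ℝ (betaHat P₀ z - betaHat P₀ x) (∑ i ∈ Finset.Ico m n, (ω i - x)))) *
          posteriorWeight P₀ (fun i : Fin m => ω i) z ∂η) /
        priorIntegral P₀ η (fun i : Fin m => ω i) := by
  rw [predictiveDensity, ← lintegral_const_mul' _ _ ENNReal.ofReal_ne_top]
  congr 1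
  refine lintegral_congr fun z => ?_
  have hz := betaHat_mem_canonicalSpace (P₀ := P₀) z
  have hxΓ := betaHat_mem_canonicalSpace (P₀ := P₀) x
  have hnn : ∀ i ∈ Finset.Ico m n, 0 ≤ density P₀ (betaHat P₀ z) (ω i) := fun i _ =>
    div_nonneg (Real.exp_pos _).le (partition_pos hz).le
  rw [← ENNReal.ofReal_prod_of_nonneg hnn,
    prod_density hz, prod_density hxΓ, ← mul_assoc, ← ENNReal.ofReal_mul (Real.exp_pos _).le,
    ← Real.exp_add]
  congr 3
  have hsum : ∑ i ∈ Finset.Ico m n, ω i =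
      ∑ i ∈ Finset.Ico m n, (ω i - x) + ((n : ℝ) - m) • x := by
    rw [Finset.sum_sub_distrib, Finset.sum_const, Nat.card_Ico, ← Nat.cast_smul_eq_nsmul ℝ,
      Nat.cast_sub hmn, sub_add_cancel]
  rw [hsum, Nat.card_Ico, Nat.cast_sub hmn, bregman, meanMap_betaHat hΓ hcc hx]
  simp only [inner_add_right, inner_smul_right, inner_sub_left, inner_sub_right]
  rw [real_inner_comm x, real_inner_comm x (betaHat P₀ x)]
  ring

/-- For every c < J the hypothesis on g puts g√det V strictly below W·I/c, so the Laplace bound caps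
the predictive density at W/(c(n/2π)^{d/2}) times the P^x-density of the new outcomes. The maximized
likelihood is at least W times that density. -/
theorem le_liminf_regret (hΓ : (interior (canonicalSpace P₀)).Nonempty)
    (hcc : (interior (convexCore P₀)).Nonempty) (hx : x ∈ interior (meanRange P₀))
    {η : Measure (EuclideanSpace ℝ (Fin d))} (hη : η (meanRange P₀)ᶜ = 0) {m : ℕ}
    {ω : ℕ → EuclideanSpace ℝ (Fin d)} (hdef : IsDefinedAt P₀ η fun i : Fin m => ω i)
    {g J : ℝ≥0∞} (hlim : ∀ T : EuclideanSpace ℝ (Fin d) ≃L[ℝ] EuclideanSpace ℝ (Fin d),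
      Tendsto (fun r => ((η.restrict (interior (meanRange P₀))).withDensity
        (posteriorWeight P₀ fun i : Fin m => ω i)) (ellipsoid T x r) /
        volume (ellipsoid T x r)) (𝓝[>] 0) (𝓝 g))
    (hg : g * J ≤ posteriorWeight P₀ (fun i : Fin m => ω i) x /
      ENNReal.ofReal (Real.sqrt (covMatrix P₀ x).det) * priorIntegral P₀ η fun i : Fin m => ω i)
    {K : ℝ} (hK : ∀ n, ‖∑ i ∈ Finset.Ico m n, (ω i - x)‖ ≤ K) :
    ENNReal.log J ≤ liminf (fun n : ℕ => regret P₀ η m n ω -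
      (((d : ℝ) / 2 * Real.log ((n : ℝ) / (2 * Real.pi)) : ℝ) : EReal)) atTop := by
  have hbΓ := betaHat_mem_interior hΓ hcc hx
  have hv0 : 0 < Real.sqrt (covMatrix P₀ x).det :=
    Real.sqrt_pos.2 (posDef_covMatrix hcc hbΓ).det_pos
  obtain ⟨L, hL0, hL⟩ := exists_posteriorWeight_eq hdef.1
  have hI0 := hdef.1
  have hIt := hdef.2
  set V := ENNReal.ofReal (Real.sqrt (covMatrix P₀ x).det) with hV
  have hV0 : V ≠ 0 := (ENNReal.ofReal_pos.2 hv0).ne'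
  have hVt : V ≠ ∞ := ENNReal.ofReal_ne_top
  set I := priorIntegral P₀ η fun i : Fin m => ω i with hI
  set W := posteriorWeight P₀ (fun i : Fin m => ω i) x with hW
  have hW0 : W ≠ 0 := by rw [hW, hL]; exact (ENNReal.ofReal_pos.2 (Real.exp_pos _)).ne'
  have hWt : W ≠ ∞ := by rw [hW, hL]; exact ENNReal.ofReal_ne_top
  have hWI0 : W * I ≠ 0 := mul_ne_zero hW0 hI0
  have hWIt : W * I ≠ ∞ := ENNReal.mul_ne_top hWt hIt
  have hg' : g * V * J ≤ W * I := by
    calc g * V * J = V * (g * J) := by ring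
      _ ≤ V * (W / V * I) := mul_le_mul' le_rfl hg
      _ = (V * (W / V)) * I := by ring
      _ = W * I := by rw [ENNReal.mul_div_cancel hV0 hVt]
  -- A level c strictly below J is needed because the Laplace bound requires a strict inequality.
  refine le_of_forall_lt_imp_le_of_dense fun c' hc' => ?_
  obtain ⟨c, hcc', hcJ⟩ := exists_between
    (show EReal.exp c' < J by rwa [← ENNReal.exp_log J, EReal.exp_lt_exp_iff])
  have hc0 : c ≠ 0 := (pos_of_gt hcc').ne'
  have hct : c ≠ ∞ := hcJ.ne_top
  have hga : g * V < W * I / c := by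
    rw [ENNReal.lt_div_iff_mul_lt (Or.inl hc0) (Or.inl hct)]
    -- Multiplying c < J by gV stays strict only if gV is neither 0 nor ∞; ∞ is excluded by gVJ ≤ WI
    -- < ∞ with J > 0.
    by_cases hgV : g * V = 0
    · rw [hgV, zero_mul]; exact pos_iff_ne_zero.2 hWI0
    · have hgVt : g * V ≠ ∞ := by
        intro h
        rw [h, ENNReal.top_mul (pos_of_gt hcJ).ne'] at hg'
        exact hWIt (top_le_iff.1 hg')
      exact ((ENNReal.mul_lt_mul_iff_right hgV hgVt).2 hcJ).trans_le hg'
  have hlap := eventually_laplace_le hΓ hcc hx hη (aemeasurable_posteriorWeight hΓ hcc hI0) hIt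
    hlim hga m K
  -- Once the average lies in M, `betaHat` gives its maximum likelihood element and not the default
  -- value 0.
  have hmean := (tendsto_sampleMean hK).eventually (isOpen_interior.mem_nhds hx)
  refine le_liminf_of_le (by isBoundedDefault) ?_
  filter_upwards [hlap, hmean, eventually_ge_atTop m, eventually_gt_atTop 0] with n h1 h2 hmn hn0
  have hn0 : (0 : ℝ) < n := by exact_mod_cast hn0
  have hq0 : 0 < (n : ℝ) / (2 * Real.pi) := by positivity
  set q := ENNReal.ofReal (((n : ℝ) / (2 * Real.pi)) ^ ((d : ℝ) / 2)) with hq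
  have hqlog : (((d : ℝ) / 2 * Real.log ((n : ℝ) / (2 * Real.pi)) : ℝ) : EReal) =
      ENNReal.log q := by
    rw [hq, ENNReal.log_ofReal_of_pos (Real.rpow_pos_of_pos hq0 _), Real.log_rpow hq0]
  refine (show c' ≤ ENNReal.log c by
    rw [← EReal.log_exp c']; exact ENNReal.log_le_log_iff.2 hcc'.le).trans ?_
  rw [EReal.le_sub_iff_add_le (Or.inl (EReal.coe_ne_bot _)) (Or.inl (EReal.coe_ne_top _)), hqlog,
    ← ENNReal.log_mul_add, regret]
  refine ENNReal.log_le_log_iff.2 ?_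
  set γ := betaHat P₀ (sampleMean fun i : Fin n => ω i) with hγ
  have hγΓ : γ ∈ canonicalSpace P₀ := betaHat_mem_canonicalSpace _
  have hbΓ' := interior_subset hbΓ
  set e := ENNReal.ofReal (∏ i ∈ Finset.Ico m n, density P₀ (betaHat P₀ x) (ω i)) with he
  -- The maximum likelihood at the average is at least P^x(x^n), whose factor on x^m is W·exp(mL) ≥
  -- W.
  have hnum : W * e ≤ ENNReal.ofReal (∏ i ∈ Finset.range n, density P₀ γ (ω i)) := by
    rw [hW, hL, he, prod_density hbΓ', prod_density hγΓ,
      ← ENNReal.ofReal_mul (Real.exp_pos _).le, ← Real.exp_add]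
    refine ENNReal.ofReal_le_ofReal (Real.exp_le_exp.2 ?_)
    have h3 := mul_le_mul_of_nonneg_left
      (log_density_le (hasMean_betaHat (interior_subset h2)) hbΓ') hn0.le
    rw [natCast_mul_log_density hbΓ', ← hγ, natCast_mul_log_density hγΓ,
      ← Finset.sum_range_add_sum_Ico _ hmn, inner_add_right] at h3
    rw [Finset.card_range, Nat.card_Ico, Nat.cast_sub hmn, ← Finset.sum_range_add_sum_Ico _ hmn,
      mul_sub, natCast_mul_log_density hbΓ']
    have h4 : 0 ≤ (m : ℝ) * L := by positivity
    linarith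
  have hnum0 : ENNReal.ofReal (∏ i ∈ Finset.range n, density P₀ γ (ω i)) ≠ 0 := by
    rw [prod_density hγΓ]; exact (ENNReal.ofReal_pos.2 (Real.exp_pos _)).ne'
  rw [ENNReal.le_div_iff_mul_le (Or.inr hnum0) (Or.inr ENNReal.ofReal_ne_top),
    predictiveDensity_eq hΓ hcc hx η hmn]
  refine le_trans ?_ hnum
  have h5 := h1 _ (hK n)
  set A := ∫⁻ z, ENNReal.ofReal (Real.exp
          (-(((n : ℝ) - m) * bregman P₀ (betaHat P₀ x) (betaHat P₀ z)) +
            inner ℝ (betaHat P₀ z - betaHat P₀ x) (∑ i ∈ Finset.Ico m n, (ω i - x)))) *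
          posteriorWeight P₀ (fun i : Fin m => ω i) z ∂η
  calc c * q * (e * A / I) = c * e * (q * A) / I := by
        rw [div_eq_mul_inv, div_eq_mul_inv]; ring
    _ ≤ c * e * (W * I / c) / I := by gcongr
    _ = (c * (W * I / c)) * e / I := by rw [mul_right_comm]
    _ = W * e := by
        rw [ENNReal.mul_div_cancel hc0 hct, mul_right_comm, mul_div_assoc,
          ENNReal.div_self hI0 hIt, mul_one]

end ExpFam

/-! ### The two continuations of the given string. -/

theorem mainTheorem5 {d : ℕ} (P₀ : Measure (EuclideanSpace ℝ (Fin d))) [IsProbabilityMeasure P₀]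
    (hΓ : (interior (ExpFam.canonicalSpace P₀)).Nonempty)
    (hcc : (interior (ExpFam.convexCore P₀)).Nonempty)
    (η : Measure (EuclideanSpace ℝ (Fin d))) (hη : η (ExpFam.meanRange P₀)ᶜ = 0)
    {m : ℕ} (xm : Fin m → EuclideanSpace ℝ (Fin d))
    (hdef : ExpFam.IsDefinedAt P₀ η xm)
    (hJ : ExpFam.condJeffreys P₀ xm ≠ ∞) :
    ∃ x ∈ ExpFam.meanRange P₀ ∩ interior (ExpFam.convexCore P₀),
      (∃ ω : ℕ → EuclideanSpace ℝ (Fin d),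
        (∀ i : Fin m, ω i = xm i) ∧
        Tendsto ω atTop (𝓝 x) ∧
        ENNReal.log (ExpFam.condJeffreys P₀ xm) ≤
          liminf (fun n : ℕ => ExpFam.regret P₀ η m n ω -
            (((d : ℝ) / 2 * Real.log ((n : ℝ) / (2 * Real.pi)) : ℝ) : EReal)) atTop) ∧
      (∃ ω : ℕ → EuclideanSpace ℝ (Fin d),
        (∀ i : Fin m, ω i = xm i) ∧
        (∀ n, m ≤ n → ω n ∈ P₀.support) ∧
        Tendsto (fun n : ℕ => ExpFam.sampleMean fun i : Fin n => ω i) atTop (𝓝 x) ∧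
        ENNReal.log (ExpFam.condJeffreys P₀ xm) ≤
          liminf (fun n : ℕ => ExpFam.regret P₀ η m n ω -
            (((d : ℝ) / 2 * Real.log ((n : ℝ) / (2 * Real.pi)) : ℝ) : EReal)) atTop) := by
  obtain ⟨x, hx, g, hlim, hg⟩ := ExpFam.exists_rnDeriv_mul_le hΓ hcc η
    (ExpFam.posteriorWeight P₀ xm) hdef.2 hJ
  have hxcc := ExpFam.interior_meanRange_subset hcc hx
  -- `ext y` is the string `xm` followed by the sequence `y`.
  obtain ⟨ext, hext, hext'⟩ : ∃ ext : (ℕ → EuclideanSpace ℝ (Fin d)) → ℕ →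
      EuclideanSpace ℝ (Fin d), (∀ y (i : Fin m), ext y i = xm i) ∧
        ∀ y n, m ≤ n → ext y n = y (n - m) :=
    ⟨fun y i => if h : i < m then xm ⟨i, h⟩ else y (i - m), fun y i => dif_pos i.2,
      fun y n h => dif_neg (not_lt.2 h)⟩
  have hsum : ∀ y n, ∑ i ∈ Finset.Ico m n, (ext y i - x) =
      ∑ k ∈ Finset.range (n - m), (y k - x) := by
    intro y n
    rw [Finset.sum_Ico_eq_sum_range]
    refine Finset.sum_congr rfl fun k _ => ?_
    rw [hext' y _ (Nat.le_add_right m k), Nat.add_sub_cancel_left]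
  have key : ∀ (y : ℕ → EuclideanSpace ℝ (Fin d)) (K : ℝ),
      (∀ n, ‖∑ k ∈ Finset.range n, (y k - x)‖ ≤ K) →
      ENNReal.log (ExpFam.condJeffreys P₀ xm) ≤
          liminf (fun n : ℕ => ExpFam.regret P₀ η m n (ext y) -
            (((d : ℝ) / 2 * Real.log ((n : ℝ) / (2 * Real.pi)) : ℝ) : EReal)) atTop := by
    intro y K hK
    have hxm : (fun i : Fin m => ext y i) = xm := funext (hext y)
    refine ExpFam.le_liminf_regret (g := g) (K := K) hΓ hcc hx hη ?_ ?_ ?_ fun n => ?_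
    · rwa [hxm]
    · rwa [hxm]
    · rwa [hxm]
    · rw [hsum]; exact hK _
  -- Repeating x itself makes every sum of deviations zero, so K = 0 serves.
  refine ⟨x, ⟨interior_subset hx, hxcc⟩, ⟨ext fun _ => x, hext _, ?_, key _ 0 (by simp)⟩, ?_⟩
  · refine tendsto_const_nhds.congr' ?_
    filter_upwards [eventually_ge_atTop m] with n hn
    exact (hext' (fun _ => x) n hn).symm
  · obtain ⟨y, hy, K, hK⟩ := ExpFam.exists_support_seq_bounded_sum hxcc
    refine ⟨ext y, hext y, fun n hn => ?_, ?_, key y K hK⟩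
    · rw [hext' y n hn]; exact hy _
    · exact ExpFam.tendsto_sampleMean (m := m) (K := K) fun n => by rw [hsum]; exact hK _
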